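/- Stabilizer operations on qubits are adaptive sequences of Clifford unitaries, preparations of qubits in $|0\rangle$, measurements of Pauli observables, and discarding of qubits. Write $|A\rangle\to|B\rangle$ if stabilizer operations convert $|A\rangle$ into $|B\rangle$ exactly and with certainty, and $|A\rangle\overset{|C\rangle}{\Longrightarrow}|B\rangle$ (conversion with catalyst $|C\rangle$) if $|A\rangle|C\rangle\to|B\rangle|C\rangle$. For an $n$-qubit state $|\psi\rangle$ let $\mathrm{Stab}|\psi\rangle$ be the set of elements $P$ of the $n$-qubit Pauli group with $P|\psi\rangle=|\psi\rangle$, and let $\nu(|\psi\rangle)=n-\log_2|\mathrm{Stab}|\psi\rangle|$ be the stabilizer nullity. Let $|T\rangle=T|+\rangle$ with $T=\mathrm{diag}(1,e^{i\pi/4})$. Let $U$ be a diagonal $n$-qubit unitary in the third level of the Clifford hierarchy and $|U\rangle=U|+\rangle^{\otimes n}$. Then $U$ can be implemented, up to a global phase, by a circuit over $\{\mathrm{CNOT},S,T\}$. Let $\tau(U)$ be the minimum number of $T$ gates in such a circuit, and write $\tau=\tau(U)$, $\nu=\nu(|U\rangle)$. Then $\nu$ is a non-negative integer, $\nu\le\tau$,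 and $$|U\rangle\,|T\rangle^{\otimes(\tau-\nu)}\to|T\rangle^{\otimes\nu}.$$ In particular, if $\tau\le 2\nu$, then $$|U\rangle\overset{|T\rangle^{\otimes(\tau-\nu)}}{\Longrightarrow}|T\rangle^{\otimes(2\nu-\tau)}.$$ For every $n\ge2$ let $W_n=\sum_{x\in\{0,1\}^n}\exp(i\pi g(x)/4)\,|x\rangle\langle x|$ with $g(x)=(x_1\oplus\cdots\oplus x_n)+\sum_{i=1}^n x_i$, where $\oplus$ is addition modulo $2$. Then $W_n$ is a diagonal unitary in the third level of the Clifford hierarchy, $\nu(|W_n\rangle)=n$, $\tau(W_n)=n+1$, and $$|W_n\rangle\overset{|T\rangle}{\Longrightarrow}|T\rangle^{\otimes(n-1)}.$$ -/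

import Mathlib

noncomputable section

namespace StabConv

/-! ### Registers, operators and states -/

/-- Labels of the computational basis of `n` qubits. -/
abbrev Bits (n : ℕ) : Type := Fin n → ZMod 2

/-- Operators on `n` qubits, written in the computational basis. -/
abbrev Op (n : ℕ) : Type := Matrix (Bits n) (Bits n) ℂ

/-- State vectors of `n` qubits, written in the computational basis. -/
abbrev Ket (n : ℕ) : Type := Bits n → ℂ

/-- The tensor product `|ψ⟩|φ⟩`. -/
def tensor {m n : ℕ} (ψ : Ket m) (φ : Ket n) : Ket (m + n) :=
  fun x => ψ (fun i => x (Fin.castAdd n i)) * φ (fun j => x (Fin.natAdd m j))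

/-- `k` copies of a one-qubit state. -/
def copies (k : ℕ) (v : ZMod 2 → ℂ) : Ket k := fun x => ∏ i, v (x i)

/-- The density matrix `|ψ⟩⟨ψ|`. -/
def density {n : ℕ} (ψ : Ket n) : Op n := Matrix.vecMulVec ψ (star ψ)

/-- The one-qubit state `|+⟩`. -/
def ketPlus : ZMod 2 → ℂ := fun _ => 1 / (Real.sqrt 2 : ℂ)

/-- The phase `exp(iπ/4)`. -/
def zeta8 : ℂ := Complex.exp (Complex.I * Real.pi / 4)

/-- The one-qubit gate `T = diag(1, exp(iπ/4))`. -/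
def matT : Matrix (ZMod 2) (ZMod 2) ℂ := Matrix.diagonal fun b => zeta8 ^ b.val

/-- The one-qubit state `|T⟩ = T|+⟩`. -/
def ketT : ZMod 2 → ℂ := matT.mulVec ketPlus

/-- The state `|U⟩ = U|+⟩^{⊗n}`. -/
def magicState {n : ℕ} (U : Op n) : Ket n := U.mulVec (copies n ketPlus)

/-! ### Pauli group and Clifford hierarchy -/

/-- The Pauli operator `i^k X(a) Z(b)`, which sends `|y⟩` to `i^k (-1)^{b·y} |y + a⟩`. Here
`X(a) Z(b)` is the tensor product of the one-qubit operators `X^{a_j} Z^{b_j}`, and `Y = i X Z`. -/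
def pauli {n : ℕ} (k : Fin 4) (a b : Bits n) : Op n :=
  fun x y => if x = y + a then Complex.I ^ (k : ℕ) * ∏ j, (-1 : ℂ) ^ (b j * y j).val else 0

/-- The `n`-qubit Pauli group: tensor products of `I, X, Y, Z` with phases `±1, ±i`. -/
def pauliGroup (n : ℕ) : Set (Op n) := {P | ∃ k a b, P = pauli k a b}

/-- The levels `1, 2, 3, …` of the Clifford hierarchy: level 1 is the Pauli group, and `U` is in
level `k + 1` if it is unitary and conjugates every Pauli operator into level `k`. Level 2 is
the Clifford group. (There is no level 0.) -/
def cliffordHierarchy (n : ℕ) : ℕ → Set (Op n)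
  | 0 => ∅
  | 1 => pauliGroup n
  | k + 2 => {U | U ∈ Matrix.unitaryGroup (Bits n) ℂ ∧
      ∀ P ∈ pauliGroup n, U * P * star U ∈ cliffordHierarchy n (k + 1)}

/-! ### Stabilizer nullity -/

/-- `Stab|ψ⟩`, the Pauli operators that fix `|ψ⟩`. -/
def stab {n : ℕ} (ψ : Ket n) : Set (Op n) := {P | P ∈ pauliGroup n ∧ P.mulVec ψ = ψ}

/-- The stabilizer nullity `ν(|ψ⟩) = n - log₂ |Stab|ψ⟩|`. -/
def nullity {n : ℕ} (ψ : Ket n) : ℝ := n - Real.logb 2 (stab ψ).ncard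

/-! ### Circuits over `{CNOT, S, T}` and the T-count -/

/-- Gates of the set `{CNOT, S, T}` placed on `n` qubits. -/
inductive Gate (n : ℕ) : Type
  | cnot (control target : Fin n) (h : control ≠ target) : Gate n
  | phaseS (q : Fin n) : Gate n
  | phaseT (q : Fin n) : Gate n

/-- The unitary of a gate. -/
def Gate.mat {n : ℕ} : Gate n → Op n
  | .cnot c t _ => fun y x => if y = Function.update x t (x t + x c) then 1 else 0
  | .phaseS q => Matrix.diagonal fun x => Complex.I ^ (x q).val
  | .phaseT q => Matrix.diagonal fun x => zeta8 ^ (x q).val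

/-- Whether a gate is a `T` gate. -/
def Gate.isT {n : ℕ} : Gate n → Bool
  | .phaseT _ => true
  | _ => false

/-- The circuit `c`, a list of gates (the last one acts first), implements `U` up to a global
phase. -/
def Implements {n : ℕ} (c : List (Gate n)) (U : Op n) : Prop :=
  ∃ z : ℂ, ‖z‖ = 1 ∧ U = z • (c.map Gate.mat).prod

/-- The number of `T` gates of a circuit. -/
def numT {n : ℕ} (c : List (Gate n)) : ℕ := c.countP Gate.isT

/-- `τ(U)`, the least number of `T` gates of a circuit over `{CNOT, S, T}` that implements `U`. -/
def tCount {n : ℕ} (U : Op n) : ℕ := sInf {t | ∃ c : List (Gate n), Implements c U ∧ numT c = t}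

/-! ### Stabilizer operations and conversion of states -/

/-- Adaptive protocols of stabilizer operations that take `n` qubits to `m` qubits: Clifford
unitaries, preparation of a fresh qubit in `|0⟩`, measurement of a Pauli observable (the rest of
the protocol may depend on the outcome), and discarding of a qubit. -/
inductive StabProtocol : ℕ → ℕ → Type
  | done (n : ℕ) : StabProtocol n n
  | clifford {n m : ℕ} (C : Op n) (hC : C ∈ cliffordHierarchy n 2) (next : StabProtocol n m) :
      StabProtocol n m
  | prepare {n m : ℕ} (next : StabProtocol (n + 1) m) : StabProtocol n m
  | measure {n m : ℕ} (P : Op n) (hP : P ∈ pauliGroup n) (hH : P.IsHermitian)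
      (onPlus onMinus : StabProtocol n m) : StabProtocol n m
  | discard {n m : ℕ} (next : StabProtocol n m) : StabProtocol (n + 1) m

/-- `ρ ⊗ |0⟩⟨0|`, the new qubit being the last one. -/
def addZero {n : ℕ} (ρ : Op n) : Op (n + 1) := fun x y =>
  if x (Fin.last n) = 0 ∧ y (Fin.last n) = 0 then ρ (fun i => x i.castSucc) (fun i => y i.castSucc)
  else 0

/-- The partial trace over the last qubit. -/
def traceLast {n : ℕ} (ρ : Op (n + 1)) : Op n := fun x y =>
  ∑ b : ZMod 2, ρ (Fin.snoc (α := fun _ => ZMod 2) x b) (Fin.snoc (α := fun _ => ZMod 2) y b)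

/-- The projector `(1 + P)/2`. -/
def projector {n : ℕ} (P : Op n) : Op n := (1 / 2 : ℂ) • (1 + P)

/-- The output density matrix of a protocol, averaged over the measurement outcomes. -/
def StabProtocol.run : {n m : ℕ} → StabProtocol n m → Op n → Op m
  | _, _, .done _, ρ => ρ
  | _, _, .clifford C _ next, ρ => next.run (C * ρ * star C)
  | _, _, .prepare next, ρ => next.run (addZero ρ)
  | _, _, .measure P _ _ onPlus onMinus, ρ =>
      onPlus.run (projector P * ρ * projector P) +
        onMinus.run (projector (-P) * ρ * projector (-P))
  | _, _, .discard next, ρ => next.run (traceLast ρ)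

/-- `|A⟩ → |B⟩`: some stabilizer protocol takes `|A⟩` to `|B⟩`, exactly and with certainty. -/
def Converts {n m : ℕ} (A : Ket n) (B : Ket m) : Prop :=
  ∃ p : StabProtocol n m, p.run (density A) = density B

/-- `|A⟩ ⇒ |B⟩` with catalyst `|C⟩`, that is `|A⟩|C⟩ → |B⟩|C⟩`. -/
def ConvertsWith {n m k : ℕ} (A : Ket n) (C : Ket k) (B : Ket m) : Prop :=
  Converts (tensor A C) (tensor B C)

/-! ### The family `W_n` -/

/-- `g(x) = (x₁ ⊕ ⋯ ⊕ xₙ) + (x₁ + ⋯ + xₙ)`, where only the first sum is modulo 2. -/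
def gW {n : ℕ} (x : Bits n) : ℕ := (∑ i, x i).val + ∑ i, (x i).val

/-- `W_n = ∑ₓ exp(iπ g(x)/4) |x⟩⟨x|`. -/
def matW (n : ℕ) : Op n :=
  Matrix.diagonal fun x => Complex.exp (Complex.I * Real.pi * (gW x : ℂ) / 4)

end StabConv

end

open StabConv

/-! Write U = diag(d). Membership of U in the third level means that the multiplicative derivatives
d(x + a)/d(x) are Clifford phases, whose own derivatives are Pauli phases. Integrating twice
(`exists_parityPhase_of_derivatives`) shows that d is a constant times a product of factors `zeta8 ^
ℓ(x)` with ℓ linear. Each factor costs one `T`, so circuits exist. Conversely, a circuit with t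
gates `T` gives d = q · ∏ `zeta8 ^ ℓ_j(x)` with t forms and a Clifford phase q
(`exists_parities_of_implements`).

Stabilizers of |U⟩ correspond to the directions a along which d changes by a Pauli phase, so ν is
the dimension of a complement W of the space of these directions. A common zero of all ℓ_j is such a
direction. Hence the ℓ_j separate the points of W and ν of them form a basis of its dual
(`exists_dual_coordinates`). Now tie each of the τ - ν ancillas |T⟩ to one of the leftover forms:
every leftover phase then occurs twice, and `zeta8 ^ 2 = I` makes it Clifford. On each coset of the
resulting ν-dimensional subspace the amplitudes are those of |T⟩^{⊗ν} up to a Clifford phase.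
Measuring the coset and undoing the phase completes the conversion (`converts_of_parities`).

For W_n the invariant is the third derivative of d, a sign whose exponent is the trilinear form ∑
ℓ_j(x) ℓ_j(y) ℓ_j(w). Clifford factors do not affect it and Pauli symmetries lie in its kernel. It
gives ν = n and excludes τ = n. -/

noncomputable section

namespace StabConv

/-! ### Phase functions of the diagonal Clifford hierarchy -/

section Phases

variable {V W : Type*} [AddCommGroup V] [Module (ZMod 2) V] [AddCommGroup W] [Module (ZMod 2) W]

/-- Functions `x ↦ i^k (-1)^{ℓ(x)}` with `ℓ` linear. -/
def PauliPhase (h : V → ℂ) : Prop :=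
  ∃ (k : ℕ) (l : V →ₗ[ZMod 2] ZMod 2), ∀ x, h x = Complex.I ^ k * (-1) ^ (l x).val

/-- Unimodular functions whose multiplicative derivatives are Pauli phases. -/
def CliffPhase (c : V → ℂ) : Prop :=
  (∀ x, ‖c x‖ = 1) ∧ ∀ a, ∃ h, PauliPhase h ∧ ∀ x, c (x + a) = h x * c x

/-- Unimodular functions whose multiplicative derivatives are Clifford phases. -/
def ThirdPhase (d : V → ℂ) : Prop :=
  (∀ x, ‖d x‖ = 1) ∧ ∀ a, ∃ h, CliffPhase h ∧ ∀ x, d (x + a) = h x * d x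

theorem zmod_two_cases (u : ZMod 2) : u = 0 ∨ u = 1 := by
  revert u; decide

theorem neg_one_pow_val_add (u v : ZMod 2) :
    (-1 : ℂ) ^ (u + v).val = (-1) ^ u.val * (-1) ^ v.val := by
  rcases zmod_two_cases u with rfl | rfl <;> rcases zmod_two_cases v with rfl | rfl
  · simp
  · simp
  · simp
  · simp [show (1 + 1 : ZMod 2) = 0 from rfl, ZMod.val_one]

theorem add_add_self (x a : V) : x + a + a = x := by
  rw [add_assoc, ZModModule.add_self, add_zero]

theorem zeta8_pow_four : zeta8 ^ 4 = -1 := by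
  rw [zeta8, ← Complex.exp_nat_mul, ← Complex.exp_pi_mul_I]
  congr 1; push_cast; ring

theorem zeta8_sq : zeta8 ^ 2 = Complex.I := by
  rw [zeta8, ← Complex.exp_nat_mul]
  refine Eq.trans ?_ Complex.exp_pi_div_two_mul_I
  congr 1; push_cast; ring

theorem norm_zeta8 : ‖zeta8‖ = 1 := by
  have : zeta8 = Complex.exp ((Real.pi / 4 : ℝ) * Complex.I) := by
    rw [zeta8]; congr 1; push_cast; ring
  rw [this, Complex.norm_exp_ofReal_mul_I]

theorem zeta8_ne_zero : zeta8 ≠ 0 := Complex.exp_ne_zero _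

theorem PauliPhase.mul {f g : V → ℂ} (hf : PauliPhase f) (hg : PauliPhase g) :
    PauliPhase (f * g) := by
  obtain ⟨k, l, h⟩ := hf
  obtain ⟨k', l', h'⟩ := hg
  refine ⟨k + k', l + l', fun x => ?_⟩
  rw [Pi.mul_apply, h, h', LinearMap.add_apply, neg_one_pow_val_add, pow_add]
  ring

theorem PauliPhase.comp {f : V → ℂ} (hf : PauliPhase f) (L : W →ₗ[ZMod 2] V) (v : V) :
    PauliPhase (fun x => f (L x + v)) := by
  obtain ⟨k, l, h⟩ := hf
  refine ⟨k + 2 * (l v).val, l ∘ₗ L, fun x => ?_⟩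
  beta_reduce
  rw [h, map_add, neg_one_pow_val_add, pow_add, pow_mul, Complex.I_sq, LinearMap.comp_apply]
  ring

theorem PauliPhase.translate {f : V → ℂ} (hf : PauliPhase f) (v : V) :
    PauliPhase (fun x => f (x + v)) := hf.comp LinearMap.id v

theorem PauliPhase.one : PauliPhase (1 : V → ℂ) := ⟨0, 0, by simp⟩

theorem PauliPhase.norm {f : V → ℂ} (hf : PauliPhase f) (x : V) : ‖f x‖ = 1 := by
  obtain ⟨k, l, h⟩ := hf
  simp [h]

theorem PauliPhase.conj {f : V → ℂ} (hf : PauliPhase f) : PauliPhase (star f) := by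
  obtain ⟨k, l, h⟩ := hf
  refine ⟨3 * k, l, fun x => ?_⟩
  simp [h, pow_mul, Complex.I_pow_three]

theorem PauliPhase.map_add {f : V → ℂ} (hf : PauliPhase f) (x y : V) :
    f (x + y) * f 0 = f x * f y := by
  obtain ⟨k, l, h⟩ := hf
  simp only [h, _root_.map_add, neg_one_pow_val_add, map_zero, ZMod.val_zero, pow_zero]
  ring

theorem PauliPhase.cliffPhase {f : V → ℂ} (hf : PauliPhase f) : CliffPhase f := by
  refine ⟨hf.norm, fun a => ?_⟩
  obtain ⟨k, l, h⟩ := hf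
  refine ⟨fun _ => (-1) ^ (l a).val, ⟨2 * (l a).val, 0, fun x => ?_⟩, fun x => ?_⟩
  · simp [pow_mul]
  · rw [h, h, _root_.map_add, neg_one_pow_val_add]; ring

theorem CliffPhase.mul {f g : V → ℂ} (hf : CliffPhase f) (hg : CliffPhase g) :
    CliffPhase (f * g) := by
  refine ⟨fun x => by simp [hf.1 x, hg.1 x], fun a => ?_⟩
  obtain ⟨h, hh, e⟩ := hf.2 a
  obtain ⟨h', hh', e'⟩ := hg.2 a
  refine ⟨h * h', hh.mul hh', fun x => ?_⟩
  simp only [Pi.mul_apply, e, e']; ring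

theorem CliffPhase.one : CliffPhase (1 : V → ℂ) := PauliPhase.one.cliffPhase

theorem CliffPhase.const {z : ℂ} (hz : ‖z‖ = 1) : CliffPhase (fun _ : V => z) :=
  ⟨fun _ => hz, fun _ => ⟨1, PauliPhase.one, by simp⟩⟩

theorem CliffPhase.prod {ι : Type*} (s : Finset ι) (f : ι → V → ℂ)
    (hf : ∀ i ∈ s, CliffPhase (f i)) : CliffPhase (∏ i ∈ s, f i) :=
  Finset.prod_induction f CliffPhase (fun _ _ => CliffPhase.mul) CliffPhase.one hf

theorem CliffPhase.conj {f : V → ℂ} (hf : CliffPhase f) : CliffPhase (star f) := by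
  refine ⟨fun x => by simp [hf.1 x], fun a => ?_⟩
  obtain ⟨h, hh, e⟩ := hf.2 a
  exact ⟨star h, hh.conj, fun x => by simp [e]⟩

theorem CliffPhase.comp {f : V → ℂ} (hf : CliffPhase f) (L : W →ₗ[ZMod 2] V) (v : V) :
    CliffPhase (fun x => f (L x + v)) := by
  refine ⟨fun x => hf.1 _, fun a => ?_⟩
  obtain ⟨h, hh, e⟩ := hf.2 (L a)
  refine ⟨fun x => h (L x + v), hh.comp L v, fun x => ?_⟩
  beta_reduce
  rw [_root_.map_add, ← e]
  congr 1; abel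

theorem cliffPhase_I_pow (l : V →ₗ[ZMod 2] ZMod 2) :
    CliffPhase (fun x => Complex.I ^ (l x).val) := by
  refine ⟨fun x => by simp, fun a => ?_⟩
  rcases zmod_two_cases (l a) with ha | ha
  · exact ⟨1, PauliPhase.one, fun x => by simp [ha]⟩
  · refine ⟨fun x => Complex.I ^ 1 * (-1) ^ (l x).val, ⟨1, l, fun _ => rfl⟩, fun x => ?_⟩
    rcases zmod_two_cases (l x) with hx | hx <;> simp [ha, hx, ZMod.val_one]
    · rw [show (1 + 1 : ZMod 2) = 0 from rfl]; simp

/-- For c = 1 the bit b = ℓ(x) is replaced by 1 - b, and `zeta8 ^ (1 - b) = zeta8 * I ^ (-b) * zeta8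
^ b`. Affine shifts of parities therefore cost only Clifford phases. -/
theorem exists_cliffPhase_zeta8_pow_add (l : V →ₗ[ZMod 2] ZMod 2) (c : ZMod 2) :
    ∃ F : V → ℂ, CliffPhase F ∧ ∀ x, zeta8 ^ (l x + c).val = F x * zeta8 ^ (l x).val := by
  rcases zmod_two_cases c with rfl | rfl
  · exact ⟨1, CliffPhase.one, fun x => by simp⟩
  · refine ⟨(fun _ => zeta8) * star (fun x => Complex.I ^ (l x).val),
      (CliffPhase.const norm_zeta8).mul (cliffPhase_I_pow l).conj, fun x => ?_⟩
    rcases zmod_two_cases (l x) with hx | hx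
    · simp [hx, ZMod.val_one]
    · rw [Pi.mul_apply, Pi.star_apply, hx, show (1 + 1 : ZMod 2) = 0 from rfl]
      simp only [ZMod.val_zero, ZMod.val_one, pow_one, pow_zero, Complex.star_def, Complex.conj_I]
      linear_combination Complex.I * zeta8_sq + Complex.I_sq

theorem thirdPhase_zeta8_pow (l : V →ₗ[ZMod 2] ZMod 2) :
    ThirdPhase (fun x => zeta8 ^ (l x).val) := by
  refine ⟨fun x => by simp [norm_zeta8], fun a => ?_⟩
  obtain ⟨F, hF, e⟩ := exists_cliffPhase_zeta8_pow_add l (l a)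
  exact ⟨F, hF, fun x => by simp only [_root_.map_add, e]⟩

theorem ThirdPhase.mul {f g : V → ℂ} (hf : ThirdPhase f) (hg : ThirdPhase g) :
    ThirdPhase (f * g) := by
  refine ⟨fun x => by simp [hf.1 x, hg.1 x], fun a => ?_⟩
  obtain ⟨h, hh, e⟩ := hf.2 a
  obtain ⟨h', hh', e'⟩ := hg.2 a
  refine ⟨h * h', hh.mul hh', fun x => ?_⟩
  simp only [Pi.mul_apply, e, e']; ring

theorem ThirdPhase.one : ThirdPhase (1 : V → ℂ) :=
  ⟨by simp, fun _ => ⟨1, CliffPhase.one, by simp⟩⟩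

theorem ThirdPhase.prod {ι : Type*} (s : Finset ι) (f : ι → V → ℂ)
    (hf : ∀ i ∈ s, ThirdPhase (f i)) : ThirdPhase (∏ i ∈ s, f i) :=
  Finset.prod_induction f ThirdPhase (fun _ _ => ThirdPhase.mul) ThirdPhase.one hf

theorem CliffPhase.ne_zero {f : V → ℂ} (hf : CliffPhase f) (x : V) : f x ≠ 0 := by
  rw [← norm_pos_iff, hf.1 x]; exact one_pos

theorem ThirdPhase.ne_zero {f : V → ℂ} (hf : ThirdPhase f) (x : V) : f x ≠ 0 := by
  rw [← norm_pos_iff, hf.1 x]; exact one_pos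

end Phases

/-! ### Generalised permutation operators -/

/-- The operator `|y⟩ ↦ h(y) |y + a⟩`. -/
def transOp {n : ℕ} (a : Bits n) (h : Bits n → ℂ) : Op n :=
  fun x y => if x = y + a then h y else 0

theorem eq_add_comm_of_bits {n : ℕ} {x y a : Bits n} : x = y + a ↔ y = x + a := by
  constructor <;> rintro rfl <;> rw [add_add_self]

theorem transOp_mul {n : ℕ} (a b : Bits n) (h g : Bits n → ℂ) :
    transOp a h * transOp b g = transOp (a + b) (fun y => h (y + b) * g y) := by
  ext x y
  simp only [Matrix.mul_apply, transOp, mul_ite, mul_zero, Finset.sum_ite_eq', Finset.mem_univ,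
    if_true, ite_mul, zero_mul]
  rw [add_right_comm, ← add_assoc, add_right_comm]

theorem star_transOp {n : ℕ} (a : Bits n) (h : Bits n → ℂ) :
    star (transOp a h) = transOp a (fun y => star (h (y + a))) := by
  ext x y
  simp only [Matrix.star_apply, transOp]
  by_cases e : x = y + a
  · rw [if_pos e, if_pos (eq_add_comm_of_bits.1 e), e]
  · rw [if_neg e, if_neg (fun e' => e (eq_add_comm_of_bits.1 e')), star_zero]

theorem diagonal_eq_transOp {n : ℕ} (d : Bits n → ℂ) : Matrix.diagonal d = transOp 0 d := by
  ext x y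
  rw [Matrix.diagonal_apply, transOp, add_zero]
  split_ifs with e
  · rw [e]
  · rfl

theorem one_eq_transOp {n : ℕ} : (1 : Op n) = transOp 0 1 := by
  rw [← diagonal_eq_transOp]; rfl

theorem transOp_apply_add {n : ℕ} (a : Bits n) (h : Bits n → ℂ) (y : Bits n) :
    transOp a h (y + a) y = h y := if_pos rfl

theorem transOp_injective {n : ℕ} (a : Bits n) : Function.Injective (transOp a) := by
  intro h g e
  ext y
  rw [← transOp_apply_add a h, e, transOp_apply_add]

theorem prod_neg_one_pow_val {n : ℕ} (v : Bits n) :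
    ∏ j, (-1 : ℂ) ^ (v j).val = (-1) ^ (∑ j, v j).val := by
  induction n with
  | zero => simp
  | succ n ih => rw [Fin.prod_univ_succ, Fin.sum_univ_succ, neg_one_pow_val_add, ← ih]

theorem pauli_eq_transOp {n : ℕ} (k : Fin 4) (a b : Bits n) :
    pauli k a b = transOp a fun y => Complex.I ^ (k : ℕ) * (-1) ^ (∑ j, b j * y j).val := by
  ext x y
  simp only [pauli, transOp, prod_neg_one_pow_val (fun j => b j * y j)]

theorem linear_form_eq_sum {n : ℕ} (l : Bits n →ₗ[ZMod 2] ZMod 2) (x : Bits n) :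
    l x = ∑ j, l (Pi.single j 1) * x j := by
  conv_lhs => rw [← Finset.univ_sum_single x, map_sum]
  refine Finset.sum_congr rfl fun j _ => ?_
  rw [mul_comm, ← smul_eq_mul, ← map_smul, ← Pi.single_smul, smul_eq_mul, mul_one]

theorem transOp_mem_pauliGroup {n : ℕ} {a : Bits n} {h : Bits n → ℂ} :
    transOp a h ∈ pauliGroup n ↔ PauliPhase h := by
  constructor
  · rintro ⟨k, a', b, e⟩
    rw [pauli_eq_transOp] at e
    have ha : a' = a := by
      have h0 := congrFun (congrFun e a') 0
      by_contra hne
      simp [transOp, hne] at h0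
      exact pow_ne_zero _ Complex.I_ne_zero h0.symm
    subst ha
    have e2 := transOp_injective a' e
    refine ⟨k, ∑ j, b j • LinearMap.proj j, fun x => ?_⟩
    simp [e2]
  · rintro ⟨k, l, e⟩
    refine ⟨⟨k % 4, Nat.mod_lt _ (by norm_num)⟩, a, fun j => l (Pi.single j 1), ?_⟩
    rw [pauli_eq_transOp]
    congr 1
    ext x
    rw [e, ← linear_form_eq_sum]
    congr 1
    conv_lhs => rw [← Nat.div_add_mod k 4, pow_add, pow_mul, Complex.I_pow_four, one_pow, one_mul]

theorem mem_pauliGroup_iff {n : ℕ} {P : Op n} :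
    P ∈ pauliGroup n ↔ ∃ a h, PauliPhase h ∧ P = transOp a h := by
  constructor
  · intro hP
    obtain ⟨k, a, b, rfl⟩ := id hP
    rw [pauli_eq_transOp] at hP ⊢
    exact ⟨a, _, transOp_mem_pauliGroup.1 hP, rfl⟩
  · rintro ⟨a, h, hh, rfl⟩
    exact transOp_mem_pauliGroup.2 hh

theorem transOp_mem_unitaryGroup {n : ℕ} {a : Bits n} {h : Bits n → ℂ} :
    transOp a h ∈ Matrix.unitaryGroup (Bits n) ℂ ↔ ∀ x, ‖h x‖ = 1 := by
  rw [Matrix.mem_unitaryGroup_iff', star_transOp, transOp_mul, ZModModule.add_self, one_eq_transOp,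
    (transOp_injective _).eq_iff, funext_iff]
  refine forall_congr' fun x => ?_
  rw [add_add_self, Complex.star_def, Complex.conj_mul', Pi.one_apply]
  norm_cast
  exact pow_eq_one_iff_of_nonneg (norm_nonneg _) two_ne_zero

theorem conj_transOp {n : ℕ} (a b : Bits n) (u p : Bits n → ℂ) :
    transOp a u * transOp b p * star (transOp a u) =
      transOp b fun y => u (y + a + b) * p (y + a) * star (u (y + a)) := by
  rw [star_transOp, transOp_mul, transOp_mul]
  congr 1
  rw [add_right_comm, ZModModule.add_self, zero_add]

theorem star_mul_self_of_norm {z : ℂ} (hz : ‖z‖ = 1) : z * star z = 1 := by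
  rw [Complex.star_def, Complex.mul_conj', hz]; norm_num

/-- Conjugating X(b) produces, up to a translation of the argument, the derivative of c along b. The
diagonal part of a Pauli operator is merely translated, so testing the operators X(b) is enough. The
same mechanism one level up gives `diagonal_mem_third`. -/
theorem transOp_mem_clifford {n : ℕ} {a : Bits n} {c : Bits n → ℂ} :
    transOp a c ∈ cliffordHierarchy n 2 ↔ CliffPhase c := by
  change (transOp a c ∈ Matrix.unitaryGroup (Bits n) ℂ ∧
    ∀ P ∈ pauliGroup n, transOp a c * P * star (transOp a c) ∈ pauliGroup n) ↔ _
  rw [transOp_mem_unitaryGroup]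
  refine and_congr_right fun hc => ⟨fun H b => ?_, fun H P hP => ?_⟩
  · have := H (transOp b 1) (transOp_mem_pauliGroup.2 PauliPhase.one)
    rw [conj_transOp, transOp_mem_pauliGroup] at this
    refine ⟨_, this.translate a, fun x => ?_⟩
    simp only [add_add_self, Pi.one_apply, mul_one]
    rw [mul_assoc, mul_comm (star _), star_mul_self_of_norm (hc x), mul_one]
  · obtain ⟨b, p, hp, rfl⟩ := mem_pauliGroup_iff.1 hP
    rw [conj_transOp, transOp_mem_pauliGroup]
    obtain ⟨h, hh, e⟩ := H b
    have : (fun y => c (y + a + b) * p (y + a) * star (c (y + a))) =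
        fun y => (h * p) (y + a) := by
      ext y
      rw [e, Pi.mul_apply]
      linear_combination h (y + a) * p (y + a) * star_mul_self_of_norm (hc (y + a))
    rw [this]
    exact (hh.mul hp).translate a

theorem diagonal_mem_clifford {n : ℕ} {c : Bits n → ℂ} (hc : CliffPhase c) :
    Matrix.diagonal c ∈ cliffordHierarchy n 2 := by
  rw [diagonal_eq_transOp]; exact transOp_mem_clifford.2 hc

theorem diagonal_mem_third {n : ℕ} {d : Bits n → ℂ} :
    Matrix.diagonal d ∈ cliffordHierarchy n 3 ↔ ThirdPhase d := by
  change (Matrix.diagonal d ∈ Matrix.unitaryGroup (Bits n) ℂ ∧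
    ∀ P ∈ pauliGroup n, Matrix.diagonal d * P * star (Matrix.diagonal d) ∈
      cliffordHierarchy n 2) ↔ _
  rw [diagonal_eq_transOp, transOp_mem_unitaryGroup]
  refine and_congr_right fun hd => ⟨fun H b => ?_, fun H P hP => ?_⟩
  · have := H (transOp b 1) (transOp_mem_pauliGroup.2 PauliPhase.one)
    rw [conj_transOp, transOp_mem_clifford] at this
    refine ⟨_, this, fun x => ?_⟩
    simp only [add_zero, Pi.one_apply, mul_one]
    rw [mul_assoc, mul_comm (star _), star_mul_self_of_norm (hd x), mul_one]
  · obtain ⟨b, p, hp, rfl⟩ := mem_pauliGroup_iff.1 hP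
    rw [conj_transOp, transOp_mem_clifford]
    obtain ⟨h, hh, e⟩ := H b
    have : (fun y => d (y + 0 + b) * p (y + 0) * star (d (y + 0))) = h * p := by
      ext y
      rw [add_zero, e, Pi.mul_apply]
      linear_combination h y * p y * star_mul_self_of_norm (hd y)
    rw [this]
    exact hh.mul hp.cliffPhase

/-- The operator `|A x⟩ ↦ |x⟩` of an invertible linear map `A`. -/
def pullOp {n : ℕ} (A : Bits n ≃ₗ[ZMod 2] Bits n) : Op n := fun y x => if x = A y then 1 else 0

theorem pullOp_mul_apply {n : ℕ} (A : Bits n ≃ₗ[ZMod 2] Bits n) (M : Op n) (y x : Bits n) :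
    (pullOp A * M) y x = M (A y) x := by
  simp [Matrix.mul_apply, pullOp]

theorem mul_star_pullOp_apply {n : ℕ} (A : Bits n ≃ₗ[ZMod 2] Bits n) (M : Op n) (y x : Bits n) :
    (M * star (pullOp A)) y x = M y (A x) := by
  simp [Matrix.mul_apply, pullOp, Matrix.star_apply, apply_ite]

theorem pullOp_mem_clifford {n : ℕ} (A : Bits n ≃ₗ[ZMod 2] Bits n) :
    pullOp A ∈ cliffordHierarchy n 2 := by
  refine ⟨?_, fun P hP => ?_⟩
  · rw [Matrix.mem_unitaryGroup_iff]
    ext y x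
    rw [pullOp_mul_apply, Matrix.star_apply, pullOp, Matrix.one_apply]
    simp [apply_ite, eq_comm]
  · obtain ⟨b, p, hp, rfl⟩ := mem_pauliGroup_iff.1 hP
    have : pullOp A * transOp b p * star (pullOp A) =
        transOp (A.symm b) (fun y => p (A.toLinearMap y + 0)) := by
      ext y x
      rw [mul_star_pullOp_apply, pullOp_mul_apply, transOp, transOp, add_zero]
      congr 1
      rw [eq_iff_iff, ← A.symm.injective.eq_iff]
      simp
    rw [this]
    exact transOp_mem_pauliGroup.2 (hp.comp _ _)

/-! ### Parity phases and the structure of the diagonal third level -/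

section ParityPhases

variable {V : Type*} [AddCommGroup V] [Module (ZMod 2) V]

/-- The functions `x ↦ η^{∑ⱼ ℓⱼ(x)}`, the linear forms `ℓⱼ` being read in `{0, 1}`. -/
def parityPhases (V : Type*) [AddCommGroup V] [Module (ZMod 2) V] (η : ℂ) : Submonoid (V → ℂ) :=
  Submonoid.closure (Set.range fun (l : V →ₗ[ZMod 2] ZMod 2) x => η ^ (l x).val)

theorem parity_mem (η : ℂ) (l : V →ₗ[ZMod 2] ZMod 2) :
    (fun x => η ^ (l x).val) ∈ parityPhases V η :=
  Submonoid.subset_closure ⟨l, rfl⟩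

theorem exists_pow_of_mem_parityPhases {η : ℂ} {g : V → ℂ} (hg : g ∈ parityPhases V η) (x : V) :
    ∃ t : ℕ, g x = η ^ t := by
  induction hg using Submonoid.closure_induction with
  | mem g hg => obtain ⟨l, rfl⟩ := hg; exact ⟨_, rfl⟩
  | one => exact ⟨0, by simp⟩
  | mul f g _ _ hf hg =>
    obtain ⟨s, hs⟩ := hf
    obtain ⟨t, ht⟩ := hg
    exact ⟨s + t, by rw [Pi.mul_apply, hs, ht, pow_add]⟩

theorem parityPhases_zero {η : ℂ} {g : V → ℂ} (hg : g ∈ parityPhases V η) : g 0 = 1 := by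
  induction hg using Submonoid.closure_induction with
  | mem g hg => obtain ⟨l, rfl⟩ := hg; simp
  | one => rfl
  | mul f g _ _ hf hg => rw [Pi.mul_apply, hf, hg, one_mul]

theorem parityPhases_inv {η : ℂ} {m : ℕ} (hm : η ^ (m + 1) = 1) {g : V → ℂ}
    (hg : g ∈ parityPhases V η) : ∃ g' ∈ parityPhases V η, ∀ x, g x * g' x = 1 := by
  refine ⟨g ^ m, pow_mem hg m, fun x => ?_⟩
  obtain ⟨t, ht⟩ := exists_pow_of_mem_parityPhases hg x
  rw [Pi.pow_apply, ← pow_succ', ht, pow_right_comm, hm, one_pow]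

/-- For bits, (b ⊕ 1) + 2b = 1 + b. Differentiation thus turns parity phases of `η` into inverses of
parity phases of `η ^ 2`, up to a constant. -/
theorem parityPhases_shift {η : ℂ} {g : V → ℂ}
    (hg : g ∈ parityPhases V η) (a : V) :
    ∃ k ∈ parityPhases V (η ^ 2), ∀ x, g (x + a) * k x = g a * g x := by
  induction hg using Submonoid.closure_induction with
  | mem g hg =>
    obtain ⟨l, rfl⟩ := hg
    rcases zmod_two_cases (l a) with ha | ha
    · exact ⟨1, one_mem _, fun x => by simp [ha]⟩
    · refine ⟨_, parity_mem _ l, fun x => ?_⟩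
      rcases zmod_two_cases (l x) with hx | hx <;> simp only [map_add, ha, hx]
      · simp
      · rw [show (1 + 1 : ZMod 2) = 0 from rfl]
        simp only [ZMod.val_zero, ZMod.val_one, pow_one, pow_zero]; ring
  | one => exact ⟨1, one_mem _, by simp⟩
  | mul f g _ _ hf hg =>
    obtain ⟨k, hk, e⟩ := hf
    obtain ⟨k', hk', e'⟩ := hg
    refine ⟨k * k', mul_mem hk hk', fun x => ?_⟩
    simp only [Pi.mul_apply]
    linear_combination g (x + a) * k' x * e x + f a * f x * e' x

end ParityPhases

/-- The identity 2ab = a + b - (a ⊕ b) expresses the controlled phase `(η ^ 2) ^ (ab)` through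
parities. Here a is the bit `x i` and b is ℓ with its dependence on that bit removed. The m-th power
serves as the inverse because `η ^ (m + 1) = 1`. -/
theorem parityPhases_control {n : ℕ} {η : ℂ} {m : ℕ} (hm : η ^ (m + 1) = 1) (i : Fin n)
    {g : Bits n → ℂ} (hg : g ∈ parityPhases (Bits n) (η ^ 2)) :
    ∃ g' ∈ parityPhases (Bits n) η, ∀ x, x i = 0 →
      g' x = 1 ∧ g' (x + Pi.single i 1) = g x := by
  induction hg using Submonoid.closure_induction with
  | mem g hg =>
    obtain ⟨l, rfl⟩ := hg
    let p : Bits n →ₗ[ZMod 2] ZMod 2 := LinearMap.proj i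
    let q : Bits n →ₗ[ZMod 2] ZMod 2 := l - l (Pi.single i 1) • p
    refine ⟨_, mul_mem (mul_mem (parity_mem η p) (parity_mem η q))
      (pow_mem (parity_mem η (p + q)) m), fun x hx => ?_⟩
    have hp : p x = 0 := hx
    have hp1 : p (Pi.single i 1) = 1 := by simp [p]
    have hq : q x = l x := by simp [q, hp]
    have hq1 : q (Pi.single i 1) = 0 := by simp [q, hp1]
    have key : ∀ t : ℕ, (η ^ t) * (η ^ t) ^ m = 1 := fun t => by
      rw [← pow_succ', pow_right_comm, hm, one_pow]
    constructor
    · simp only [Pi.mul_apply, Pi.pow_apply, LinearMap.add_apply, hp, hq, zero_add]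
      simp [key]
    · simp only [Pi.mul_apply, Pi.pow_apply, LinearMap.add_apply, map_add, hp, hq, hp1, hq1,
        zero_add, add_zero]
      rcases zmod_two_cases (l x) with h | h
      · simpa [h, ZMod.val_one] using key 1
      · rw [h, show (1 + 1 : ZMod 2) = 0 from rfl]
        simp only [ZMod.val_one, ZMod.val_zero]
        ring
  | one => exact ⟨1, one_mem _, by simp⟩
  | mul f g _ _ hf hg =>
    obtain ⟨k, hk, e⟩ := hf
    obtain ⟨k', hk', e'⟩ := hg
    refine ⟨k * k', mul_mem hk hk', fun x hx => ?_⟩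
    simp [e x hx, e' x hx]

/-- A function whose derivatives along the coordinate axes are, up to constants, parity phases
of `η ^ 2` is, up to a constant, a parity phase of `η`. -/
theorem exists_parityPhase_of_derivatives {n : ℕ} {η : ℂ} {r : ℕ} (hr : η ^ r = -1)
    {d : Bits n → ℂ} (hd : ∀ x, d x ≠ 0)
    (H : ∀ i, ∃ g ∈ parityPhases (Bits n) (η ^ 2), ∀ x,
      d (x + Pi.single i 1) * d 0 = d (Pi.single i 1) * g x * d x) :
    ∃ g ∈ parityPhases (Bits n) η, ∀ x, d x = d 0 * g x := by
  have hη : η ≠ 0 := by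
    rintro rfl
    rcases Nat.eq_zero_or_pos r with rfl | h
    · norm_num at hr
    · rw [zero_pow h.ne'] at hr; norm_num at hr
  obtain ⟨m, hm⟩ : ∃ m, η ^ (m + 1) = 1 := by
    rcases Nat.eq_zero_or_pos r with rfl | h
    · norm_num at hr
    · refine ⟨2 * r - 1, ?_⟩
      rw [Nat.sub_add_cancel (by omega), mul_comm, pow_mul, hr]; norm_num
  have hm2 : (η ^ 2) ^ (m + 1) = 1 := by rw [pow_right_comm, hm, one_pow]
  suffices h : ∀ s : Finset (Fin n), ∃ g ∈ parityPhases (Bits n) η,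
      ∀ x, (∀ i ∉ s, x i = 0) → d x = d 0 * g x by
    obtain ⟨g, hg, e⟩ := h Finset.univ
    exact ⟨g, hg, fun x => e x (by simp)⟩
  intro s
  induction s using Finset.induction_on with
  | empty =>
    refine ⟨1, one_mem _, fun x hx => ?_⟩
    have : x = 0 := funext fun i => hx i (by simp)
    simp [this]
  | insert i s hi ih =>
    obtain ⟨g, hg, e⟩ := ih
    obtain ⟨f, hf, ef⟩ := H i
    obtain ⟨k, hk, ek⟩ := parityPhases_shift hg (Pi.single i 1)
    obtain ⟨g', hg', eg'⟩ := parityPhases_control hm i (mul_mem hf hk)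
    set v : Bits n := Pi.single i 1 with hv
    have hvv : v + v = 0 := ZModModule.add_self v
    obtain ⟨gi, -, egi⟩ := parityPhases_inv hm hg
    have hgv : g v ≠ 0 := left_ne_zero_of_mul_eq_one (egi v)
    -- The constant of integration. Moving twice along `v` returns to the start, so the square of
    -- d(v)/(d(0) g(v)) is a power of `η ^ 2`. The remaining sign is absorbed by `η ^ r = -1`.
    obtain ⟨t, ht⟩ : ∃ t : ℕ, d v = d 0 * g v * η ^ t := by
      obtain ⟨a, ha⟩ := exists_pow_of_mem_parityPhases (mul_mem hf hk) v
      obtain ⟨b, hb⟩ : ∃ b : ℕ, η ^ a * η ^ b = 1 := ⟨a * m, by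
        rw [← pow_add, show a + a * m = (m + 1) * a by ring, pow_mul, hm, one_pow]⟩
      have e1 := ef v
      have e2 := ek v
      rw [hvv] at e1 e2
      rw [parityPhases_zero hg, one_mul] at e2
      have hsq : (d v * η ^ a) ^ 2 = (d 0 * g v) ^ 2 := by
        rw [Pi.mul_apply] at ha
        rw [mul_pow, pow_right_comm, ← ha]
        linear_combination -k v * e1 + d 0 ^ 2 * e2
      rcases sq_eq_sq_iff_eq_or_eq_neg.1 hsq with h | h
      · exact ⟨b, by linear_combination η ^ b * h - d v * hb⟩
      · exact ⟨b + r, by rw [pow_add, hr]; linear_combination η ^ b * h - d v * hb⟩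
    have hxi : (fun x : Bits n => η ^ (x i).val) ∈ parityPhases (Bits n) η :=
      parity_mem η (LinearMap.proj i : Bits n →ₗ[ZMod 2] ZMod 2)
    -- `g'` switches on the derivative `f`, corrected by `k` for the shift of `g`, exactly when the
    -- i-th bit is 1. The last factor supplies the constant of integration.
    refine ⟨g * g' * (fun x => η ^ (x i).val) ^ t, mul_mem (mul_mem hg hg') (pow_mem hxi t), fun x hx => ?_⟩
    rcases zmod_two_cases (x i) with h0 | h1
    · have hxs : ∀ j ∉ s, x j = 0 := fun j hj => by
        by_cases hji : j = i
        · rw [hji, h0]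
        · exact hx j (by simp [hji, hj])
      simp [e x hxs, (eg' x h0).1, h0]
    · obtain ⟨y, rfl⟩ : ∃ y, x = y + v := ⟨x + v, (add_add_self x v).symm⟩
      have hyi : y i = 0 := by
        have : y i + 1 = 1 := by simpa [hv] using h1
        simpa using this
      have hys : ∀ j ∉ s, y j = 0 := fun j hj => by
        by_cases hji : j = i
        · rw [hji, hyi]
        · simpa [hv, hji] using hx j (by simp [hji, hj])
      have h1' : (y + v) i = 1 := h1
      apply mul_right_cancel₀ (hd 0)
      rw [ef y, e y hys]
      simp only [Pi.mul_apply, Pi.pow_apply, (eg' y hyi).2, h1', ZMod.val_one, pow_one]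
      rw [ht]
      linear_combination -d 0 ^ 2 * f y * η ^ t * ek y

theorem CliffPhase.exists_parityPhase {n : ℕ} {c : Bits n → ℂ} (hc : CliffPhase c) :
    ∃ g ∈ parityPhases (Bits n) Complex.I, ∀ x, c x = c 0 * g x := by
  refine exists_parityPhase_of_derivatives Complex.I_sq hc.ne_zero fun i => ?_
  obtain ⟨h, ⟨k, l, e⟩, eh⟩ := hc.2 (Pi.single i 1)
  refine ⟨_, parity_mem _ l, fun x => ?_⟩
  have h0 := eh 0
  rw [zero_add] at h0
  rw [h0, eh x, e, e, Complex.I_sq]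
  simp only [map_zero, ZMod.val_zero]
  ring

/-- The second integration: the derivatives of d are Clifford phases, hence parity phases of `I =
zeta8 ^ 2` up to constants. -/
theorem ThirdPhase.exists_parityPhase {n : ℕ} {d : Bits n → ℂ} (hd : ThirdPhase d) :
    ∃ g ∈ parityPhases (Bits n) zeta8, ∀ x, d x = d 0 * g x := by
  refine exists_parityPhase_of_derivatives zeta8_pow_four hd.ne_zero fun i => ?_
  obtain ⟨h, hh, eh⟩ := hd.2 (Pi.single i 1)
  obtain ⟨g, hg, e⟩ := hh.exists_parityPhase
  refine ⟨g, by rwa [zeta8_sq], fun x => ?_⟩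
  have h0 := eh 0
  rw [zero_add] at h0
  rw [h0, eh x, e]
  ring

/-! ### Circuits -/

/-- The operator `|x⟩ ↦ f(x) |A x⟩`. -/
def monoOp {n : ℕ} (A : Bits n →ₗ[ZMod 2] Bits n) (f : Bits n → ℂ) : Op n :=
  fun y x => if y = A x then f x else 0

theorem monoOp_mul {n : ℕ} (A B : Bits n →ₗ[ZMod 2] Bits n) (f g : Bits n → ℂ) :
    monoOp A f * monoOp B g = monoOp (A ∘ₗ B) (fun x => f (B x) * g x) := by
  ext y x
  simp [Matrix.mul_apply, monoOp]

theorem diagonal_eq_monoOp {n : ℕ} (d : Bits n → ℂ) :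
    Matrix.diagonal d = monoOp LinearMap.id d := by
  ext x y
  rw [Matrix.diagonal_apply, monoOp, LinearMap.id_apply]
  split_ifs with e
  · rw [e]
  · rfl

/-- The action of a `CNOT` gate on basis labels. -/
def cnotMap {n : ℕ} (c t : Fin n) : Bits n →ₗ[ZMod 2] Bits n :=
  LinearMap.id + LinearMap.single (ZMod 2) (fun _ => ZMod 2) t ∘ₗ LinearMap.proj c

theorem cnotMap_apply {n : ℕ} (c t : Fin n) (x : Bits n) :
    cnotMap c t x = Function.update x t (x t + x c) := by
  ext j
  by_cases h : j = t
  · subst h; simp [cnotMap]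
  · simp [cnotMap, h]

theorem mat_cnot {n : ℕ} (c t : Fin n) (h : c ≠ t) :
    (Gate.cnot c t h).mat = monoOp (cnotMap c t) 1 := by
  ext y x
  simp [Gate.mat, monoOp, cnotMap_apply]

theorem cnotMap_cnotMap {n : ℕ} {c t : Fin n} (h : c ≠ t) (x : Bits n) :
    cnotMap c t (cnotMap c t x) = x := by
  ext j
  by_cases hj : j = t
  · subst hj
    simp only [cnotMap_apply, Function.update_self, Function.update_of_ne h]
    exact add_add_self _ _
  · simp [cnotMap_apply, hj]

/-- The diagonal operator of `d` has a circuit with at most `k` gates `T`. -/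
def HasCircuit {n : ℕ} (k : ℕ) (d : Bits n → ℂ) : Prop :=
  ∃ c : List (Gate n), Implements c (Matrix.diagonal d) ∧ numT c ≤ k

theorem HasCircuit.mul {n k k' : ℕ} {d d' : Bits n → ℂ} (h : HasCircuit k d)
    (h' : HasCircuit k' d') : HasCircuit (k + k') (d * d') := by
  obtain ⟨c, ⟨z, hz, e⟩, hc⟩ := h
  obtain ⟨c', ⟨z', hz', e'⟩, hc'⟩ := h'
  refine ⟨c ++ c', ⟨z * z', by simp [hz, hz'], ?_⟩, ?_⟩
  · rw [List.map_append, List.prod_append, ← smul_mul_smul_comm, ← e, ← e',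
      Matrix.diagonal_mul_diagonal]
    rfl
  · rw [numT, List.countP_append]
    exact add_le_add hc hc'

theorem HasCircuit.const {n : ℕ} {z : ℂ} (hz : ‖z‖ = 1) :
    HasCircuit 0 (fun _ : Bits n => z) :=
  ⟨[], ⟨z, hz, by rw [List.map_nil, List.prod_nil, Matrix.smul_one_eq_diagonal]⟩, le_rfl⟩

theorem HasCircuit.one {n : ℕ} : HasCircuit 0 (1 : Bits n → ℂ) := HasCircuit.const norm_one

theorem HasCircuit.prod {n : ℕ} {ι : Type*} (s : Finset ι) (f : ι → Bits n → ℂ)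
    (hf : ∀ i ∈ s, HasCircuit 1 (f i)) : HasCircuit s.card (∏ i ∈ s, f i) := by
  classical
  induction s using Finset.induction_on with
  | empty => exact HasCircuit.one
  | insert i s hi ih =>
    rw [Finset.prod_insert hi, Finset.card_insert_of_notMem hi, add_comm]
    exact (hf i (by simp)).mul (ih fun j hj => hf j (by simp [hj]))

theorem HasCircuit.comp_cnotMap {n k : ℕ} {d : Bits n → ℂ} (h : HasCircuit k d) {c t : Fin n}
    (hct : c ≠ t) : HasCircuit k (fun x => d (cnotMap c t x)) := by
  obtain ⟨l, ⟨z, hz, e⟩, hl⟩ := h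
  refine ⟨Gate.cnot c t hct :: (l ++ [Gate.cnot c t hct]), ⟨z, hz, ?_⟩, ?_⟩
  · rw [List.map_cons, List.map_append, List.prod_cons, List.prod_append, List.map_singleton,
      List.prod_singleton, ← mul_smul_comm, ← smul_mul_assoc, ← e, mat_cnot, diagonal_eq_monoOp,
      diagonal_eq_monoOp, monoOp_mul, monoOp_mul]
    congr 1
    · exact LinearMap.ext fun x => (cnotMap_cnotMap hct x).symm
    · ext x; simp
  · simpa [numT, Gate.isT] using hl

/-- CNOTs into a qubit t of the support of ℓ accumulate the parity there; a single `T` on t,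
followed by the reversed CNOTs, gives the phase. -/
theorem hasCircuit_zeta8_pow {n : ℕ} (l : Bits n →ₗ[ZMod 2] ZMod 2) :
    HasCircuit 1 (fun x => zeta8 ^ (l x).val) := by
  have key : ∀ (t : Fin n) (s : Finset (Fin n)), t ∉ s →
      HasCircuit 1 (fun x : Bits n => zeta8 ^ (x t + ∑ i ∈ s, x i).val) := by
    intro t s
    induction s using Finset.induction_on with
    | empty =>
      intro _
      exact ⟨[Gate.phaseT t], ⟨1, norm_one, by simp [Gate.mat]⟩, by simp [numT, Gate.isT]⟩
    | insert c s hc ih =>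
      intro ht
      rw [Finset.mem_insert, not_or] at ht
      convert (ih ht.2).comp_cnotMap (c := c) (t := t) (Ne.symm ht.1) using 4 with x
      rw [Finset.sum_insert hc, ← add_assoc, cnotMap_apply, Function.update_self]
      congr 1
      refine Finset.sum_congr rfl fun j hj => ?_
      rw [Function.update_of_ne]
      rintro rfl
      exact ht.2 hj
  have hl : ∀ x, l x = ∑ j ∈ Finset.univ.filter (fun j => l (Pi.single j 1) = 1), x j := by
    intro x
    rw [linear_form_eq_sum, Finset.sum_filter]
    refine Finset.sum_congr rfl fun j _ => ?_
    rcases zmod_two_cases (l (Pi.single j 1)) with h | h <;> simp [h]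
  set s := Finset.univ.filter (fun j => l (Pi.single j 1) = 1)
  rcases s.eq_empty_or_nonempty with h | ⟨t, ht⟩
  · have : (fun x => zeta8 ^ (l x).val) = (1 : Bits n → ℂ) := by
      ext x; simp [hl, h]
    rw [this]
    obtain ⟨c, hc, hk⟩ := HasCircuit.one (n := n)
    exact ⟨c, hc, hk.trans zero_le_one⟩
  · convert key t (s.erase t) (by simp) using 4 with x
    rw [Finset.add_sum_erase s _ ht, hl]

theorem ThirdPhase.exists_circuit {n : ℕ} {d : Bits n → ℂ} (hd : ThirdPhase d) :
    ∃ k, HasCircuit k d := by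
  obtain ⟨g, hg, e⟩ := hd.exists_parityPhase
  suffices h : ∃ k, HasCircuit k g by
    obtain ⟨k, hk⟩ := h
    refine ⟨0 + k, ?_⟩
    have := (HasCircuit.const (n := n) (hd.1 0)).mul hk
    rwa [show (fun _ => d 0) * g = d from funext fun x => (e x).symm] at this
  clear e
  induction hg using Submonoid.closure_induction with
  | mem g hg => obtain ⟨l, rfl⟩ := hg; exact ⟨1, hasCircuit_zeta8_pow l⟩
  | one => exact ⟨0, HasCircuit.one⟩
  | mul f g _ _ hf hg =>
    obtain ⟨k, hk⟩ := hf
    obtain ⟨k', hk'⟩ := hg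
    exact ⟨_, hk.mul hk'⟩

/-- CNOTs only relabel basis states linearly, so each `T` sees a linear form of the input bits, and
each `S` contributes a Clifford phase. -/
theorem exists_monoOp_of_circuit {n : ℕ} (c : List (Gate n)) :
    ∃ (A : Bits n →ₗ[ZMod 2] Bits n) (l : Fin (numT c) → Bits n →ₗ[ZMod 2] ZMod 2)
      (q : Bits n → ℂ), CliffPhase q ∧
      (c.map Gate.mat).prod = monoOp A (fun x => (∏ j, zeta8 ^ (l j x).val) * q x) := by
  induction c with
  | nil =>
    refine ⟨LinearMap.id, fun _ => 0, 1, CliffPhase.one, ?_⟩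
    rw [List.map_nil, List.prod_nil, ← diagonal_eq_monoOp, ← Matrix.diagonal_one]
    congr 1; ext x; simp
  | cons g c ih =>
    obtain ⟨A, l, q, hq, e⟩ := ih
    rw [List.map_cons, List.prod_cons, e]
    cases g with
    | cnot i t h =>
      have hT : numT (Gate.cnot i t h :: c) = numT c := by simp [numT, Gate.isT]
      rw [hT, mat_cnot, monoOp_mul]
      exact ⟨_, l, q, hq, by simp only [Pi.one_apply, one_mul]; rfl⟩
    | phaseS i =>
      have hT : numT (Gate.phaseS i :: c) = numT c := by simp [numT, Gate.isT]
      rw [hT, Gate.mat, diagonal_eq_monoOp, monoOp_mul]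
      refine ⟨LinearMap.id ∘ₗ A, l, _, hq.mul (cliffPhase_I_pow (LinearMap.proj i ∘ₗ A)), ?_⟩
      congr 1; ext x
      simp only [Pi.mul_apply, LinearMap.comp_apply, LinearMap.proj_apply]
      ring
    | phaseT i =>
      have hT : numT (Gate.phaseT i :: c) = numT c + 1 := List.countP_cons_of_pos rfl
      rw [hT, Gate.mat, diagonal_eq_monoOp, monoOp_mul]
      refine ⟨LinearMap.id ∘ₗ A, Fin.cons (LinearMap.proj i ∘ₗ A) l, q, hq, ?_⟩
      congr 1; ext x
      rw [Fin.prod_univ_succ]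
      simp only [Fin.cons_zero, Fin.cons_succ, LinearMap.comp_apply, LinearMap.proj_apply]
      ring

theorem exists_parities_of_implements {n : ℕ} {c : List (Gate n)} {d : Bits n → ℂ}
    (h : Implements c (Matrix.diagonal d)) :
    ∃ (l : Fin (numT c) → Bits n →ₗ[ZMod 2] ZMod 2) (q : Bits n → ℂ), CliffPhase q ∧
      ∀ x, d x = (∏ j, zeta8 ^ (l j x).val) * q x := by
  obtain ⟨z, hz, e⟩ := h
  obtain ⟨A, l, q, hq, e'⟩ := exists_monoOp_of_circuit c
  refine ⟨l, (fun _ => z) * q, (CliffPhase.const hz).mul hq, fun x => ?_⟩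
  rw [e'] at e
  have h1 := congrFun (congrFun e (A x)) x
  have hz0 : z ≠ 0 := by rw [← norm_pos_iff, hz]; exact one_pos
  rw [Matrix.smul_apply, monoOp, if_pos rfl, smul_eq_mul, Matrix.diagonal_apply] at h1
  have hne : z * ((∏ j, zeta8 ^ (l j x).val) * q x) ≠ 0 :=
    mul_ne_zero hz0 (mul_ne_zero (Finset.prod_ne_zero_iff.2 fun j _ =>
      pow_ne_zero _ zeta8_ne_zero) (hq.ne_zero x))
  -- The entry at (A x, x) is nonzero, so diagonality forces A x = x.
  by_cases hA : A x = x
  · rw [if_pos hA, hA] at h1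
    rw [h1, Pi.mul_apply]; ring
  · rw [if_neg hA] at h1
    exact absurd h1.symm hne

/-! ### Stabilizer nullity of diagonal gates -/

/-- The translations that change `d` by a Pauli phase. -/
def pauliSymmetries {V : Type*} [AddCommGroup V] [Module (ZMod 2) V] (d : V → ℂ) :
    Submodule (ZMod 2) V where
  carrier := {a | ∃ h, PauliPhase h ∧ ∀ x, d (x + a) = h x * d x}
  zero_mem' := ⟨1, PauliPhase.one, by simp⟩
  add_mem' := by
    rintro a b ⟨h, hh, e⟩ ⟨h', hh', e'⟩
    refine ⟨(fun x => h' (x + a)) * h, (hh'.translate a).mul hh, fun x => ?_⟩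
    rw [← add_assoc, e', e, Pi.mul_apply, mul_assoc]
  smul_mem' := by
    intro c a ha
    rcases zmod_two_cases c with rfl | rfl
    · rw [zero_smul]; exact ⟨1, PauliPhase.one, by simp⟩
    · rwa [one_smul]

/-- Along such a direction the `zeta8` factors do not change, and only the derivative of q remains.
-/
theorem mem_pauliSymmetries_of_parities {V ι : Type*} [AddCommGroup V] [Module (ZMod 2) V]
    [Fintype ι] {d : V → ℂ} {l : ι → V →ₗ[ZMod 2] ZMod 2} {q : V → ℂ} (hq : CliffPhase q)
    (hd : ∀ x, d x = (∏ j, zeta8 ^ (l j x).val) * q x) {a : V} (ha : ∀ j, l j a = 0) :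
    a ∈ pauliSymmetries d := by
  obtain ⟨h, hh, e⟩ := hq.2 a
  refine ⟨h, hh, fun x => ?_⟩
  simp only [hd, e, map_add, ha, add_zero]
  ring

theorem magicState_diagonal {n : ℕ} (d : Bits n → ℂ) (x : Bits n) :
    magicState (Matrix.diagonal d) x = d x * (1 / (Real.sqrt 2 : ℂ)) ^ n := by
  simp [magicState, Matrix.mulVec_diagonal, copies, ketPlus]

theorem sqrt_two_ne_zero : (Real.sqrt 2 : ℂ) ≠ 0 := by
  rw [Ne, Complex.ofReal_eq_zero]
  exact (Real.sqrt_pos.2 two_pos).ne'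

theorem transOp_mulVec_eq_iff {n : ℕ} (a : Bits n) (h ψ : Bits n → ℂ) :
    (transOp a h).mulVec ψ = ψ ↔ ∀ x, ψ (x + a) = h x * ψ x := by
  have key : ∀ x, (transOp a h).mulVec ψ (x + a) = h x * ψ x := by
    intro x
    simp [Matrix.mulVec, dotProduct, transOp]
  constructor
  · intro e x
    rw [← key, e]
  · intro e
    ext y
    obtain ⟨x, rfl⟩ : ∃ x, y = x + a := ⟨y + a, (add_add_self y a).symm⟩
    rw [key, e]

/-- A stabilizer with translation part a must carry the phase d(x + a)/d(x). It is therefore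
determined by a, and it exists exactly when that quotient is a Pauli phase. -/
theorem ncard_stab_magicState {n : ℕ} {d : Bits n → ℂ} (hd : ∀ x, d x ≠ 0) :
    (stab (magicState (Matrix.diagonal d))).ncard =
      2 ^ Module.finrank (ZMod 2) (pauliSymmetries d) := by
  have hfix : ∀ a h, (transOp a h).mulVec (magicState (Matrix.diagonal d)) =
      magicState (Matrix.diagonal d) ↔ ∀ x, d (x + a) = h x * d x := by
    intro a h
    rw [transOp_mulVec_eq_iff]
    refine forall_congr' fun x => ?_
    rw [magicState_diagonal, magicState_diagonal, ← mul_assoc, mul_left_inj']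
    exact pow_ne_zero _ (one_div_ne_zero sqrt_two_ne_zero)
  have hrange : stab (magicState (Matrix.diagonal d)) =
      Set.range fun a : pauliSymmetries d => transOp a.1 fun x => d (x + a.1) / d x := by
    ext P
    constructor
    · rintro ⟨hP, hf⟩
      obtain ⟨a, h, hh, rfl⟩ := mem_pauliGroup_iff.1 hP
      rw [hfix] at hf
      refine ⟨⟨a, h, hh, hf⟩, ?_⟩
      dsimp only
      congr 1
      ext x
      rw [hf, mul_div_cancel_right₀ _ (hd x)]
    · rintro ⟨⟨a, h, hh, e⟩, rfl⟩
      have : (fun x => d (x + a) / d x) = h := by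
        ext x; rw [e, mul_div_cancel_right₀ _ (hd x)]
      dsimp only
      rw [this]
      exact ⟨transOp_mem_pauliGroup.2 hh, (hfix a h).2 e⟩
  have hinj : Function.Injective
      fun a : pauliSymmetries d => transOp a.1 fun x => d (x + a.1) / d x := by
    intro a b e
    have h0 := congrFun (congrFun e a.1) 0
    by_contra hne
    have hne' : a.1 ≠ b.1 := fun h => hne (Subtype.ext h)
    simp [transOp, hne', hd] at h0
  rw [hrange, ← Nat.card_coe_set_eq, Nat.card_range_of_injective hinj,
    Module.natCard_eq_pow_finrank (K := ZMod 2), Nat.card_zmod]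

theorem nullity_magicState {n : ℕ} {d : Bits n → ℂ} (hd : ∀ x, d x ≠ 0) :
    nullity (magicState (Matrix.diagonal d)) =
      ((n - Module.finrank (ZMod 2) (pauliSymmetries d) : ℕ) : ℝ) := by
  have hle : Module.finrank (ZMod 2) (pauliSymmetries d) ≤ n := by
    simpa using Submodule.finrank_le (pauliSymmetries d)
  rw [nullity, ncard_stab_magicState hd, Nat.cast_sub hle, Nat.cast_pow, Nat.cast_ofNat,
    Real.logb_pow, Real.logb_self_eq_one one_lt_two, mul_one]

/-! ### Distillation protocols -/

theorem conj_density {n : ℕ} (C : Op n) (ψ : Ket n) :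
    C * density ψ * star C = density (C.mulVec ψ) := by
  rw [density, density, Matrix.mul_vecMulVec, Matrix.vecMulVec_mul, Matrix.star_mulVec]
  rfl

theorem density_smul {n : ℕ} (a : ℂ) (ψ : Ket n) :
    density (a • ψ) = (a * star a) • density ψ := by
  ext x y
  simp [density, Matrix.vecMulVec_apply]
  ring

/-- The observable `Z` of the last qubit. -/
def lastZ (n : ℕ) : Op (n + 1) := transOp 0 fun x => (-1) ^ (x (Fin.last n)).val

theorem lastZ_mem (n : ℕ) : lastZ n ∈ pauliGroup (n + 1) :=
  transOp_mem_pauliGroup.2 ⟨0, (LinearMap.proj (Fin.last n) : Bits (n + 1) →ₗ[ZMod 2] ZMod 2),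
    fun x => by simp⟩

theorem isHermitian_lastZ (n : ℕ) : (lastZ n).IsHermitian := by
  change star (lastZ n) = lastZ n
  rw [lastZ, star_transOp]
  congr 1; ext x; simp

/-- The projector onto the value `b` of the last qubit. -/
def lastProj (n : ℕ) (b : ZMod 2) : Op (n + 1) :=
  Matrix.diagonal fun x => if x (Fin.last n) = b then 1 else 0

theorem projector_lastZ (n : ℕ) : projector (lastZ n) = lastProj n 0 := by
  rw [projector, lastZ, ← diagonal_eq_transOp, ← Matrix.diagonal_one, Matrix.diagonal_add,
    ← Matrix.diagonal_smul, lastProj]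
  congr 1; ext x
  rcases zmod_two_cases (x (Fin.last n)) with h | h <;> simp [h, ZMod.val_one]
  norm_num

theorem projector_neg_lastZ (n : ℕ) : projector (-lastZ n) = lastProj n 1 := by
  have h : projector (-lastZ n) = 1 - projector (lastZ n) := by
    rw [projector, projector]; module
  rw [h, projector_lastZ, lastProj, lastProj, ← Matrix.diagonal_one, Matrix.diagonal_sub]
  congr 1; ext x
  rcases zmod_two_cases (x (Fin.last n)) with h | h <;> simp [h]

theorem traceLast_lastProj {n : ℕ} (b : ZMod 2) (ψ : Ket (n + 1)) :
    traceLast (lastProj n b * density ψ * lastProj n b) =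
      density fun x => ψ (Fin.snoc (α := fun _ => ZMod 2) x b) := by
  ext x y
  rw [traceLast, Finset.sum_eq_single b]
  · simp [lastProj, density, Matrix.vecMulVec_apply]
  · intro c _ hc
    simp [lastProj, hc]
  · simp

theorem sum_bits_succ {n : ℕ} (F : Bits (n + 1) → ℂ) :
    ∑ x, F x = ∑ x, F (Fin.snoc (α := fun _ => ZMod 2) x 0) +
      ∑ x, F (Fin.snoc (α := fun _ => ZMod 2) x 1) := by
  rw [← (Fin.snocEquiv fun _ => ZMod 2).sum_comp, Fintype.sum_prod_type]
  exact Fin.sum_univ_two _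

theorem copies_ketT {n : ℕ} (u : Bits n) :
    copies n ketT u = (∏ i, zeta8 ^ (u i).val) * (1 / (Real.sqrt 2 : ℂ)) ^ n := by
  simp [copies, ketT, matT, Matrix.mulVec_diagonal, ketPlus, Finset.prod_mul_distrib]

theorem sqrt_two_sq : (1 / (Real.sqrt 2 : ℂ)) * (1 / (Real.sqrt 2 : ℂ)) * 2 = 1 := by
  have : (Real.sqrt 2 : ℂ) * (Real.sqrt 2 : ℂ) = 2 := by
    rw [← Complex.ofReal_mul, Real.mul_self_sqrt zero_le_two]; norm_num
  field_simp
  rw [sq, this]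

theorem prod_zeta8_mul_star {n : ℕ} (u : Bits n) :
    (∏ i, zeta8 ^ (u i).val) * star (∏ i, zeta8 ^ (u i).val) = 1 :=
  star_mul_self_of_norm (by simp [norm_prod, norm_zeta8])

/-- If, for every value `w` of the last `k` qubits, the first `m` qubits are in a state that a
diagonal Clifford unitary takes to `|T⟩^{⊗m}`, then measuring the last `k` qubits gives a protocol
that prepares `|T⟩^{⊗m}`. -/
theorem exists_protocol_of_branches (m k : ℕ) (ψ : Ket (m + k))
    (H : ∀ w : Bits k, ∃ (c : ℂ) (q : Bits m → ℂ), CliffPhase q ∧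
      ∀ u, ψ (Fin.append u w) = c * ((∏ i, zeta8 ^ (u i).val) * q u)) :
    ∃ p : StabProtocol (m + k) m,
      p.run (density ψ) = (∑ x, ψ x * star (ψ x)) • density (copies m ketT) := by
  induction k with
  | zero =>
    obtain ⟨c, q, hq, e⟩ := H Fin.elim0
    have e' : ∀ u : Bits m, ψ u = c * ((∏ i, zeta8 ^ (u i).val) * q u) := fun u => by
      rw [← e, Fin.append_elim0]; rfl
    refine ⟨.clifford (Matrix.diagonal (star q)) (diagonal_mem_clifford hq.conj) (.done m), ?_⟩
    change Matrix.diagonal (star q) * density (n := m) ψ * star (Matrix.diagonal (star q)) =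
      (∑ x : Bits m, ψ x * star (ψ x)) • density (copies m ketT)
    have hsum : ∑ x : Bits m, ψ x * star (ψ x) = 2 ^ m * (c * star c) := by
      rw [Finset.sum_congr rfl (g := fun _ => c * star c)]
      · simp
      · intro x _
        rw [e', star_mul', star_mul']
        linear_combination c * star c * (q x * star (q x)) * prod_zeta8_mul_star x +
          c * star c * star_mul_self_of_norm (hq.1 x)
    have hψ : (Matrix.diagonal (star q)).mulVec ψ =
        (c * (Real.sqrt 2 : ℂ) ^ m) • copies m ketT := by
      ext u
      rw [Matrix.mulVec_diagonal, Pi.smul_apply, copies_ketT, e', Pi.star_apply, smul_eq_mul]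
      have h1 : (Real.sqrt 2 : ℂ) ^ m * (1 / (Real.sqrt 2 : ℂ)) ^ m = 1 := by
        rw [← mul_pow, mul_one_div_cancel sqrt_two_ne_zero, one_pow]
      linear_combination c * (∏ i, zeta8 ^ (u i).val) * star_mul_self_of_norm (hq.1 u) -
        c * (∏ i, zeta8 ^ (u i).val) * h1
    rw [conj_density, hψ, density_smul, hsum]
    congr 1
    have h2 : (Real.sqrt 2 : ℂ) * star (Real.sqrt 2 : ℂ) = 2 := by
      rw [Complex.star_def, Complex.conj_ofReal, ← Complex.ofReal_mul,
        Real.mul_self_sqrt zero_le_two]; norm_num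
    rw [star_mul', star_pow, ← h2, mul_pow]
    ring
  | succ k ih =>
    -- Branches are left unnormalised. Both yield the same target state, so only their squared norms
    -- have to be added.
    have branch : ∀ b : ZMod 2, ∃ p : StabProtocol (m + k) m,
        p.run (density fun x => ψ (Fin.snoc (α := fun _ => ZMod 2) x b)) =
          (∑ x, ψ (Fin.snoc (α := fun _ => ZMod 2) x b) *
            star (ψ (Fin.snoc (α := fun _ => ZMod 2) x b))) • density (copies m ketT) := by
      intro b
      refine ih _ fun w => ?_
      obtain ⟨c, q, hq, e⟩ := H (Fin.snoc (α := fun _ => ZMod 2) w b)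
      refine ⟨c, q, hq, fun u => ?_⟩
      rw [← e, Fin.append_snoc]
    obtain ⟨p₀, h₀⟩ := branch 0
    obtain ⟨p₁, h₁⟩ := branch 1
    refine ⟨.measure (lastZ (m + k)) (lastZ_mem _) (isHermitian_lastZ _) (.discard p₀)
      (.discard p₁), ?_⟩
    change p₀.run (traceLast (projector (lastZ (m + k)) * density (n := m + k + 1) ψ *
        projector (lastZ (m + k)))) + p₁.run (traceLast (projector (-lastZ (m + k)) *
        density (n := m + k + 1) ψ * projector (-lastZ (m + k)))) = _
    rw [projector_lastZ, projector_neg_lastZ, traceLast_lastProj, traceLast_lastProj, h₀, h₁,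
      ← add_smul]
    congr 1
    exact (sum_bits_succ (n := m + k) fun x => ψ x * star (ψ x)).symm

/-- Concatenation of labels as a linear equivalence. -/
def appendEquiv (m k : ℕ) : Bits (m + k) ≃ₗ[ZMod 2] Bits m × Bits k :=
  (LinearEquiv.funCongrLeft (ZMod 2) (ZMod 2) finSumFinEquiv).trans
    (LinearEquiv.sumArrowLequivProdArrow (Fin m) (Fin k) (ZMod 2) (ZMod 2))

theorem appendEquiv_append {m k : ℕ} (u : Bits m) (w : Bits k) :
    appendEquiv m k (Fin.append u w) = (u, w) := by
  ext i <;> simp [appendEquiv, LinearEquiv.funCongrLeft, LinearMap.funLeft]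

theorem exists_linearEquiv_extending {m k : ℕ} (L : Bits m →ₗ[ZMod 2] Bits (m + k))
    (hL : Function.Injective L) :
    ∃ A : (Bits m × Bits k) ≃ₗ[ZMod 2] Bits (m + k), ∀ u, A (u, 0) = L u := by
  obtain ⟨Q, hQ⟩ := Submodule.exists_isCompl (LinearMap.range L)
  have hr : Module.finrank (ZMod 2) (LinearMap.range L) = m := by
    rw [LinearMap.finrank_range_of_inj hL]; simp
  have hk : Module.finrank (ZMod 2) (Bits k) = Module.finrank (ZMod 2) Q := by
    have := Submodule.finrank_add_eq_of_isCompl hQ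
    rw [hr] at this
    simp only [Module.finrank_fin_fun] at this ⊢
    omega
  refine ⟨((LinearEquiv.ofInjective L hL).prodCongr (LinearEquiv.ofFinrankEq _ _ hk)).trans
    (Submodule.prodEquivOfIsCompl _ _ hQ), fun u => ?_⟩
  simp

/-- If the restrictions of `f` to all translates of an `m`-dimensional subspace are, up to
constants and Clifford phases, the amplitudes of `|T⟩^{⊗m}`, then `f` converts to
`|T⟩^{⊗m}`. -/
theorem converts_copies_ketT {N m : ℕ} (hm : m ≤ N) (f : Ket N) (hf : ∑ x, f x * star (f x) = 1)
    (L : Bits m →ₗ[ZMod 2] Bits N) (hL : Function.Injective L)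
    (H : ∀ h : Bits N, ∃ (c : ℂ) (q : Bits m → ℂ), CliffPhase q ∧
      ∀ u, f (L u + h) = c * ((∏ i, zeta8 ^ (u i).val) * q u)) :
    Converts f (copies m ketT) := by
  obtain ⟨k, rfl⟩ := Nat.exists_eq_add_of_le hm
  obtain ⟨A, hA⟩ := exists_linearEquiv_extending L hL
  let B : Bits (m + k) ≃ₗ[ZMod 2] Bits (m + k) := (appendEquiv m k).trans A
  have hB : (pullOp B).mulVec f = fun x => f (B x) := by
    ext x; simp [Matrix.mulVec, dotProduct, pullOp]
  -- After the relabelling `B`, the last k bits label the cosets of the range of `L`, and the first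
  -- m bits are coordinates inside a coset.
  obtain ⟨p, hp⟩ := exists_protocol_of_branches m k (fun x => f (B x)) fun w => by
    obtain ⟨c, q, hq, e⟩ := H (A (0, w))
    refine ⟨c, q, hq, fun u => ?_⟩
    rw [← e, ← hA, ← map_add]
    simp [B, appendEquiv_append]
  refine ⟨.clifford (pullOp B) (pullOp_mem_clifford B) p, ?_⟩
  change p.run (pullOp B * density f * star (pullOp B)) = _
  have hsum : ∑ x, f (B x) * star (f (B x)) = 1 :=
    (B.toEquiv.sum_comp fun x => f x * star (f x)).trans hf
  rw [conj_density, hB, hp, hsum, one_smul]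

/-! ### Conversion of diagonal third-level states -/

/-- Forms without a common nonzero zero span the dual space, so m of them form a basis. `R` inverts
the resulting coordinate map, and `e` lists the basis forms before the t - m leftover ones. -/
theorem exists_dual_coordinates {W : Type*} [AddCommGroup W] [Module (ZMod 2) W]
    [FiniteDimensional (ZMod 2) W] {m t : ℕ} (hm : Module.finrank (ZMod 2) W = m)
    (l : Fin t → W →ₗ[ZMod 2] ZMod 2) (hl : ∀ x, (∀ j, l j x = 0) → x = 0) :
    m ≤ t ∧ ∃ (e : Fin m ⊕ Fin (t - m) ≃ Fin t) (R : Bits m ≃ₗ[ZMod 2] W),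
      ∀ u i, l (e (Sum.inl i)) (R u) = u i := by
  have hspan : Submodule.span (ZMod 2) (Set.range l) = ⊤ := by
    refine eq_top_iff.2 fun K _ => mem_span_of_iInf_ker_le_ker fun x hx => ?_
    have : x = 0 := hl x fun j => by simpa using (Submodule.mem_iInf _).1 hx j
    simp [this]
  obtain ⟨κ, a, ha, hsp, hli⟩ := exists_linearIndependent' (ZMod 2) l
  rw [hspan] at hsp
  have : Fintype κ := Fintype.ofInjective a ha
  have hcard : Fintype.card κ = m := by
    rw [← hm, ← Subspace.dual_finrank_eq]
    exact (Module.finrank_eq_card_basis (Module.Basis.mk hli hsp.ge)).symm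
  let f : Fin m ≃ κ := (Fintype.equivFinOfCardEq hcard).symm
  have hinj : Function.Injective (a ∘ f) := ha.comp f.injective
  have hmt : m ≤ t := by simpa using Fintype.card_le_of_injective _ hinj
  have hP : Function.Injective (LinearMap.pi fun i => l (a (f i)) : W →ₗ[ZMod 2] Bits m) := by
    rw [← LinearMap.ker_eq_bot, LinearMap.ker_eq_bot']
    intro x hx
    have hx' : ∀ K : W →ₗ[ZMod 2] ZMod 2, K x = 0 := by
      intro K
      have hK : K ∈ Submodule.span (ZMod 2) (Set.range (l ∘ a)) := hsp ▸ Submodule.mem_top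
      induction hK using Submodule.span_induction with
      | mem K hK =>
        obtain ⟨i, rfl⟩ := hK
        simpa using congrFun hx (f.symm i)
      | zero => rfl
      | add K K' _ _ h h' => rw [LinearMap.add_apply, h, h', add_zero]
      | smul c K _ h => rw [LinearMap.smul_apply, h, smul_zero]
    exact hl x fun j => hx' _
  let P : W ≃ₗ[ZMod 2] Bits m := LinearEquiv.ofInjectiveOfFinrankEq _ hP (by simpa using hm)
  classical
  have hc : Fintype.card ((Set.range (a ∘ f))ᶜ : Set (Fin t)) = t - m := by
    rw [Fintype.card_compl_set, Set.card_range_of_injective hinj]; simp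
  refine ⟨hmt, ((Equiv.ofInjective _ hinj).sumCongr (Fintype.equivFinOfCardEq hc).symm).trans
    (Equiv.Set.sumCompl _), P.symm, fun u i => ?_⟩
  have h : ∀ x, P x i = l (a (f i)) x := fun _ => rfl
  change l (a (f i)) (P.symm u) = u i
  rw [← h, LinearEquiv.apply_symm_apply]

theorem tensor_append {m n : ℕ} (ψ : Ket m) (φ : Ket n) (x : Bits m) (y : Bits n) :
    tensor ψ φ (Fin.append x y) = ψ x * φ y := by
  simp [tensor]

theorem tensor_copies {a b : ℕ} (v : ZMod 2 → ℂ) :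
    tensor (copies a v) (copies b v) = copies (a + b) v := by
  ext x
  simp [tensor, copies, Fin.prod_univ_add]

/-- The number of qubits minus the dimension of the group of Pauli symmetries. -/
def diagNullity {n : ℕ} (d : Bits n → ℂ) : ℕ :=
  n - Module.finrank (ZMod 2) (pauliSymmetries d)

theorem sum_tensor_mul_star {n k : ℕ} {d : Bits n → ℂ} (hd : ∀ x, ‖d x‖ = 1) :
    ∑ x, tensor (magicState (Matrix.diagonal d)) (copies k ketT) x *
      star (tensor (magicState (Matrix.diagonal d)) (copies k ketT) x) = 1 := by
  have hs : star (1 / (Real.sqrt 2 : ℂ)) = 1 / (Real.sqrt 2 : ℂ) := by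
    rw [Complex.star_def, map_div₀, map_one, Complex.conj_ofReal]
  have h : ∀ x, tensor (magicState (Matrix.diagonal d)) (copies k ketT) x *
      star (tensor (magicState (Matrix.diagonal d)) (copies k ketT) x) =
      ((1 / (Real.sqrt 2 : ℂ)) * (1 / (Real.sqrt 2 : ℂ))) ^ (n + k) := by
    intro x
    rw [tensor, magicState_diagonal, copies_ketT]
    simp only [star_mul', star_pow, hs]
    set y : Bits n := fun i => x (Fin.castAdd k i)
    set w : Bits k := fun i => x (Fin.natAdd n i)
    set s := 1 / (Real.sqrt 2 : ℂ)
    have h1 := star_mul_self_of_norm (hd y)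
    have h2 := prod_zeta8_mul_star w
    calc _ = (d y * star (d y)) * ((∏ i, zeta8 ^ (w i).val) * star (∏ i, zeta8 ^ (w i).val)) *
        (s * s) ^ (n + k) := by ring
      _ = _ := by rw [h1, h2, one_mul, one_mul]
  rw [Finset.sum_congr rfl fun x _ => h x, Finset.sum_const, nsmul_eq_mul]
  have hc : (Finset.univ : Finset (Bits (n + k))).card = 2 ^ (n + k) := by simp
  rw [hc, Nat.cast_pow, Nat.cast_ofNat, ← mul_pow, mul_comm, sqrt_two_sq, one_pow]

/-- This holds for any decomposition into t parities, not only a minimal one; its inequality also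
supplies the lower bound on the T-count. -/
theorem converts_of_parities {n t : ℕ} {d q : Bits n → ℂ} (hd1 : ∀ x, ‖d x‖ = 1)
    {l : Fin t → Bits n →ₗ[ZMod 2] ZMod 2} (hq : CliffPhase q)
    (hd : ∀ x, d x = (∏ j, zeta8 ^ (l j x).val) * q x) :
    diagNullity d ≤ t ∧
      Converts (tensor (magicState (Matrix.diagonal d)) (copies (t - diagNullity d) ketT))
        (copies (diagNullity d) ketT) := by
  obtain ⟨W, hW⟩ := Submodule.exists_isCompl (pauliSymmetries d)
  have hrank : Module.finrank (ZMod 2) W = diagNullity d := by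
    have := Submodule.finrank_add_eq_of_isCompl hW
    rw [Module.finrank_fin_fun] at this
    rw [diagNullity]; omega
  obtain ⟨hle, e, R, hR⟩ := exists_dual_coordinates hrank (fun j => l j ∘ₗ W.subtype) (by
    intro x hx
    have hx' : (x : Bits n) ∈ pauliSymmetries d := mem_pauliSymmetries_of_parities hq hd hx
    exact Subtype.ext (Submodule.disjoint_def.1 hW.disjoint x hx' x.2))
  refine ⟨hle, ?_⟩
  have hmn : diagNullity d ≤ n := Nat.sub_le _ _
  generalize diagNullity d = m at *
  let Rn : Bits m →ₗ[ZMod 2] Bits n := W.subtype ∘ₗ R.toLinearMap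
  -- The graph of the leftover forms: each ancilla bit equals the value of one of them.
  let L : Bits m →ₗ[ZMod 2] Bits (n + (t - m)) := (appendEquiv n (t - m)).symm.toLinearMap ∘ₗ
    Rn.prod (LinearMap.pi fun i => l (e (Sum.inr i)) ∘ₗ Rn)
  have hRn : Function.Injective Rn := W.injective_subtype.comp R.injective
  refine converts_copies_ketT (by omega) _ (sum_tensor_mul_star hd1) L ?_ fun h => ?_
  · intro u v huv
    have := (appendEquiv n (t - m)).symm.injective huv
    exact hRn (congrArg Prod.fst this)
  · set g := ((appendEquiv n (t - m)) h).1 with hg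
    set c := ((appendEquiv n (t - m)) h).2 with hc
    have hLu : ∀ u, L u + h =
        Fin.append (Rn u + g) (fun i => l (e (Sum.inr i)) (Rn u) + c i) := by
      intro u
      apply (appendEquiv n (t - m)).injective
      rw [map_add, appendEquiv_append]
      simp only [L, LinearMap.comp_apply, LinearEquiv.coe_coe, LinearEquiv.apply_symm_apply]
      rfl
    choose F hF eF using fun j => exists_cliffPhase_zeta8_pow_add (l j ∘ₗ Rn) (l j g)
    choose F' hF' eF' using fun i =>
      exists_cliffPhase_zeta8_pow_add (l (e (Sum.inr i)) ∘ₗ Rn) (c i)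
    -- The Clifford phase collects the corrections for the coset shifts of the parities and of the
    -- ancillas, the factor q, and the doubled leftover phases `zeta8 ^ 2 = I`.
    refine ⟨(1 / (Real.sqrt 2 : ℂ)) ^ n * (1 / (Real.sqrt 2 : ℂ)) ^ (t - m),
      (∏ j, F j) * (fun u => q (Rn u + g)) * (∏ i, F' i) *
        ∏ i, fun u => Complex.I ^ (l (e (Sum.inr i)) (Rn u)).val,
      (((CliffPhase.prod _ _ fun j _ => hF j).mul (hq.comp Rn g)).mul
        (CliffPhase.prod _ _ fun i _ => hF' i)).mul
        (CliffPhase.prod _ _ fun i _ => cliffPhase_I_pow (l (e (Sum.inr i)) ∘ₗ Rn)), fun u => ?_⟩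
    rw [hLu, tensor_append, magicState_diagonal, copies_ketT, hd]
    have h1 : ∏ j, zeta8 ^ (l j (Rn u + g)).val = (∏ j, F j u) *
        ((∏ i, zeta8 ^ (u i).val) * ∏ i, zeta8 ^ (l (e (Sum.inr i)) (Rn u)).val) := by
      have : ∏ j, zeta8 ^ (l j (Rn u)).val =
          (∏ i, zeta8 ^ (u i).val) * ∏ i, zeta8 ^ (l (e (Sum.inr i)) (Rn u)).val := by
        rw [← e.prod_comp, Fintype.prod_sum_type]
        congr 1
        exact Finset.prod_congr rfl fun i _ => by rw [← hR u i]; rfl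
      rw [← this, ← Finset.prod_mul_distrib]
      exact Finset.prod_congr rfl fun j _ => by rw [map_add]; exact eF j u
    have h2 : ∏ i, zeta8 ^ (l (e (Sum.inr i)) (Rn u) + c i).val =
        (∏ i, F' i u) * ∏ i, zeta8 ^ (l (e (Sum.inr i)) (Rn u)).val := by
      rw [← Finset.prod_mul_distrib]
      exact Finset.prod_congr rfl fun i _ => eF' i u
    have h3 : (∏ i, zeta8 ^ (l (e (Sum.inr i)) (Rn u)).val) *
        (∏ i, zeta8 ^ (l (e (Sum.inr i)) (Rn u)).val) =
        ∏ i, Complex.I ^ (l (e (Sum.inr i)) (Rn u)).val := by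
      rw [← Finset.prod_mul_distrib]
      exact Finset.prod_congr rfl fun i _ => by rw [← zeta8_sq, ← pow_mul, ← pow_add, two_mul]
    simp only [Pi.mul_apply, Finset.prod_apply]
    rw [h1, h2, ← h3]
    ring

theorem HasCircuit.tCount_le {n k : ℕ} {d : Bits n → ℂ} (h : HasCircuit k d) :
    tCount (Matrix.diagonal d) ≤ k := by
  obtain ⟨c, hc, hk⟩ := h
  have hle : tCount (Matrix.diagonal d) ≤ numT c := Nat.sInf_le ⟨c, hc, rfl⟩
  exact hle.trans hk

theorem ThirdPhase.exists_parities {n : ℕ} {d : Bits n → ℂ} (hd : ThirdPhase d) :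
    ∃ (l : Fin (tCount (Matrix.diagonal d)) → Bits n →ₗ[ZMod 2] ZMod 2) (q : Bits n → ℂ),
      CliffPhase q ∧ ∀ x, d x = (∏ j, zeta8 ^ (l j x).val) * q x := by
  obtain ⟨k, c, hc, -⟩ := hd.exists_circuit
  have hne : {t | ∃ c : List (Gate n), Implements c (Matrix.diagonal d) ∧ numT c = t}.Nonempty :=
    ⟨numT c, c, hc, rfl⟩
  obtain ⟨c', hc', e⟩ := Nat.sInf_mem hne
  rw [tCount, ← e]
  exact exists_parities_of_implements hc'

theorem diagonal_conversion {n : ℕ} {U : Op n} (hU : U.IsDiag) (h3 : U ∈ cliffordHierarchy n 3) :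
    (∃ c : List (Gate n), Implements c U) ∧
      ∃ ν : ℕ, (ν : ℝ) = nullity (magicState U) ∧ ν ≤ tCount U ∧
        Converts (tensor (magicState U) (copies (tCount U - ν) ketT)) (copies ν ketT) ∧
        (tCount U ≤ 2 * ν →
          ConvertsWith (magicState U) (copies (tCount U - ν) ketT)
            (copies (2 * ν - tCount U) ketT)) := by
  obtain ⟨d, rfl⟩ : ∃ d, U = Matrix.diagonal d := ⟨_, hU.diagonal_diag.symm⟩
  have hd := diagonal_mem_third.1 h3
  obtain ⟨l, q, hq, e⟩ := hd.exists_parities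
  obtain ⟨hle, hconv⟩ := converts_of_parities hd.1 hq e
  obtain ⟨k, c, hc, -⟩ := hd.exists_circuit
  refine ⟨⟨c, hc⟩, diagNullity d, (nullity_magicState hd.ne_zero).symm, hle, hconv, fun h => ?_⟩
  -- Output and catalyst together are ν copies of |T⟩, so the catalytic claim is the previous
  -- conversion. The bound τ ≤ 2ν keeps the subtraction from truncating.
  rw [ConvertsWith, tensor_copies,
    show 2 * diagNullity d - tCount (Matrix.diagonal d) +
      (tCount (Matrix.diagonal d) - diagNullity d) = diagNullity d by omega]
  exact hconv

/-! ### Cubic forms and the family `W_n` -/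

section CubicForms

variable {V : Type*} [AddCommGroup V]

/-- `(-1)^{s(x, y, w)}` is the third multiplicative derivative of `d` at `0`. -/
def HasCubicForm (d : V → ℂ) (s : V → V → V → ZMod 2) : Prop :=
  ∀ x y w, d (x + y + w) * d x * d y * d w =
    (-1) ^ (s x y w).val * (d (x + y) * d (x + w) * d (y + w) * d 0)

theorem HasCubicForm.mul {d d' : V → ℂ} {s s' : V → V → V → ZMod 2} (h : HasCubicForm d s)
    (h' : HasCubicForm d' s') : HasCubicForm (d * d') (s + s') := by
  intro x y w
  simp only [Pi.mul_apply, Pi.add_apply, neg_one_pow_val_add]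
  calc _ = (d (x + y + w) * d x * d y * d w) * (d' (x + y + w) * d' x * d' y * d' w) := by ring
    _ = _ := by rw [h, h']; ring

theorem HasCubicForm.one : HasCubicForm (1 : V → ℂ) 0 := by
  intro x y w; simp

theorem HasCubicForm.unique {d : V → ℂ} {s s' : V → V → V → ZMod 2} (h : HasCubicForm d s)
    (h' : HasCubicForm d s') (hd : ∀ x, d x ≠ 0) (x y w : V) : s x y w = s' x y w := by
  have e : (-1 : ℂ) ^ (s x y w).val = (-1) ^ (s' x y w).val := by
    have := (h x y w).symm.trans (h' x y w)
    exact mul_right_cancel₀ (mul_ne_zero (mul_ne_zero (mul_ne_zero (hd _) (hd _)) (hd _)) (hd _))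
      this
  rcases zmod_two_cases (s x y w) with h1 | h1 <;> rcases zmod_two_cases (s' x y w) with h2 | h2 <;>
    rw [h1, h2] at e ⊢ <;> norm_num [ZMod.val_one] at e

theorem HasCubicForm.prod {ι : Type*} (t : Finset ι) {d : ι → V → ℂ}
    {s : ι → V → V → V → ZMod 2} (h : ∀ i, HasCubicForm (d i) (s i)) :
    HasCubicForm (∏ i ∈ t, d i) (∑ i ∈ t, s i) := by
  classical
  induction t using Finset.induction_on with
  | empty => exact HasCubicForm.one
  | insert i t hi ih =>
    rw [Finset.prod_insert hi, Finset.sum_insert hi]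
    exact (h i).mul ih

variable [Module (ZMod 2) V]

/-- Inclusion–exclusion for the parity of three bits leaves the term 4abc, and `zeta8 ^ 4 = -1`. -/
theorem hasCubicForm_zeta8_pow (l : V →ₗ[ZMod 2] ZMod 2) :
    HasCubicForm (fun x => zeta8 ^ (l x).val) (fun x y w => l x * l y * l w) := by
  intro x y w
  have key : ∀ a b c : ZMod 2, (a + b + c).val + a.val + b.val + c.val =
      4 * (a * b * c).val + ((a + b).val + (a + c).val + (b + c).val) := by decide
  simp only [map_add, map_zero, ZMod.val_zero, pow_zero, mul_one]
  rw [← pow_add, ← pow_add, ← pow_add, key, pow_add, pow_mul, zeta8_pow_four, pow_add, pow_add]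

theorem CliffPhase.hasCubicForm {c : V → ℂ} (hc : CliffPhase c) : HasCubicForm c 0 := by
  intro x y w
  obtain ⟨h, hh, e⟩ := hc.2 w
  have e0 := e 0
  rw [zero_add] at e0
  rw [e, e, e, e0]
  simp only [Pi.zero_apply, ZMod.val_zero, pow_zero]
  linear_combination c (x + y) * c x * c y * c 0 * hh.map_add x y

theorem hasCubicForm_of_parities {ι : Type*} [Fintype ι] {d : V → ℂ}
    {l : ι → V →ₗ[ZMod 2] ZMod 2} {q : V → ℂ} (hq : CliffPhase q)
    (hd : ∀ x, d x = (∏ j, zeta8 ^ (l j x).val) * q x) :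
    HasCubicForm d (fun x y w => ∑ j, l j x * l j y * l j w) := by
  have := (HasCubicForm.prod Finset.univ fun j => hasCubicForm_zeta8_pow (l j)).mul
    hq.hasCubicForm
  convert this using 1
  · ext x; simp [hd]
  · ext x y w; simp [Finset.sum_apply]

/-- The derivative of d along a is a Pauli phase, that is, a constant times a character. Its second
derivative is trivial, so the form vanishes with a in one slot. -/
theorem HasCubicForm.eq_zero_of_mem {d : V → ℂ} {s : V → V → V → ZMod 2} (h : HasCubicForm d s)
    (hd : ∀ x, d x ≠ 0) {a : V} (ha : a ∈ pauliSymmetries d) (x y : V) : s x y a = 0 := by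
  obtain ⟨g, hg, e⟩ := ha
  have e0 := e 0
  rw [zero_add] at e0
  have hs := h x y a
  rw [e, e, e, e0] at hs
  have hne : d (x + y) * (g x * d x) * (g y * d y) * d 0 ≠ 0 := by
    simp only [ne_eq, mul_eq_zero, hd, or_false, ← norm_eq_zero (a := g _), hg.norm,
      one_ne_zero, not_false_eq_true]
  have e1 : (-1 : ℂ) ^ (s x y a).val = 1 := by
    apply mul_right_cancel₀ hne
    rw [← hs]
    linear_combination d (x + y) * d x * d y * d 0 * hg.map_add x y
  rcases zmod_two_cases (s x y a) with h1 | h1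
  · exact h1
  · rw [h1] at e1; norm_num [ZMod.val_one] at e1

end CubicForms

/-- The linear forms `x₁ + ⋯ + xₙ` and `xᵢ`. -/
def formsW (n : ℕ) : Option (Fin n) → Bits n →ₗ[ZMod 2] ZMod 2
  | none => ∑ i, LinearMap.proj i
  | some i => LinearMap.proj i

/-- The diagonal of `W_n`. -/
def diagW (n : ℕ) : Bits n → ℂ := ∏ j, fun x => zeta8 ^ (formsW n j x).val

theorem diagW_apply {n : ℕ} (x : Bits n) : diagW n x = ∏ j, zeta8 ^ (formsW n j x).val := by
  simp [diagW]

theorem matW_eq {n : ℕ} : matW n = Matrix.diagonal (diagW n) := by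
  rw [matW]
  congr 1; ext x
  have h : Complex.exp (Complex.I * Real.pi * (gW x : ℂ) / 4) = zeta8 ^ gW x := by
    rw [zeta8, ← Complex.exp_nat_mul]
    congr 1; ring
  rw [h, diagW_apply, Fintype.prod_option, gW, pow_add, Finset.prod_pow_eq_pow_sum]
  simp [formsW]

theorem thirdPhase_diagW (n : ℕ) : ThirdPhase (diagW n) :=
  ThirdPhase.prod _ _ fun _ _ => thirdPhase_zeta8_pow _

theorem hasCubicForm_diagW (n : ℕ) : HasCubicForm (diagW n) fun x y w =>
    (∑ i, x i) * (∑ i, y i) * (∑ i, w i) + ∑ i, x i * y i * w i := by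
  have := hasCubicForm_of_parities (d := diagW n) CliffPhase.one
    fun x => by rw [diagW_apply, Pi.one_apply, mul_one]
  convert this using 4
  rw [Fintype.sum_option]
  simp [formsW]

theorem pauliSymmetries_diagW {n : ℕ} (hn : 2 ≤ n) : pauliSymmetries (diagW n) = ⊥ := by
  rw [eq_bot_iff]
  intro a ha
  have h := (hasCubicForm_diagW n).eq_zero_of_mem (thirdPhase_diagW n).ne_zero ha
  -- Two distinct unit vectors kill the diagonal term of the form and isolate the sum of the bits of
  -- a. Here n ≥ 2 is needed. A repeated unit vector then isolates each single bit.
  have hsum : ∑ i, a i = 0 := by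
    have h01 : (⟨0, by omega⟩ : Fin n) ≠ ⟨1, by omega⟩ := by simp
    have := h (Pi.single ⟨0, by omega⟩ 1) (Pi.single ⟨1, by omega⟩ 1)
    simpa [Pi.single_apply, h01.symm] using this
  rw [Submodule.mem_bot]
  ext i
  simpa [hsum, Pi.single_apply] using h (Pi.single i 1) (Pi.single i 1)

theorem diagNullity_diagW {n : ℕ} (hn : 2 ≤ n) : diagNullity (diagW n) = n := by
  rw [diagNullity, pauliSymmetries_diagW hn, finrank_bot, Nat.sub_zero]

/-- The n + 1 defining parities give the upper bound, and ν = n gives τ ≥ n. If τ = n, the n forms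
would be a basis of the dual. At the vector v dual to one of them the cubic form is ∑ ℓ_j(v) = 1,
whereas for W_n its value at (v, v, v) is ∑ v_i + ∑ v_i = 0. -/
theorem tCount_matW {n : ℕ} (hn : 2 ≤ n) : tCount (matW n) = n + 1 := by
  rw [matW_eq]
  refine le_antisymm ?_ ?_
  · have := HasCircuit.prod Finset.univ _ fun j _ => hasCircuit_zeta8_pow (formsW n j)
    have hcard : (Finset.univ : Finset (Option (Fin n))).card = n + 1 := by simp
    exact hcard ▸ this.tCount_le
  · by_contra hlt
    obtain ⟨l, q, hq, e⟩ := (thirdPhase_diagW n).exists_parities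
    have hle := (converts_of_parities (thirdPhase_diagW n).1 hq e).1
    rw [diagNullity_diagW hn] at hle
    generalize tCount (Matrix.diagonal (diagW n)) = t at *
    obtain rfl : n = t := by omega
    have hinj : Function.Injective (LinearMap.pi l : Bits n →ₗ[ZMod 2] Bits n) := by
      rw [← LinearMap.ker_eq_bot, LinearMap.ker_eq_bot']
      intro x hx
      have := mem_pauliSymmetries_of_parities hq e fun j => congrFun hx j
      rwa [pauliSymmetries_diagW hn, Submodule.mem_bot] at this
    obtain ⟨v, hv⟩ := LinearMap.injective_iff_surjective.1 hinj (Pi.single ⟨0, by omega⟩ 1)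
    have hv' : ∀ j, l j v = (Pi.single ⟨0, by omega⟩ 1 : Bits n) j := fun j => congrFun hv j
    have hs := (hasCubicForm_diagW n).unique (hasCubicForm_of_parities hq e)
      (thirdPhase_diagW n).ne_zero v v v
    have hsq : ∀ a : ZMod 2, a * a * a = a := by decide
    simp only [hsq, hv', ZModModule.add_self] at hs
    simp at hs

end StabConv

end

open StabConv
theorem mainTheorem7 :
    (∀ (n : ℕ) (U : Op n), U.IsDiag → U ∈ cliffordHierarchy n 3 →
      (∃ c : List (Gate n), Implements c U) ∧
      ∃ ν : ℕ, (ν : ℝ) = nullity (magicState U) ∧ ν ≤ tCount U ∧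
        Converts (tensor (magicState U) (copies (tCount U - ν) ketT)) (copies ν ketT) ∧
        (tCount U ≤ 2 * ν →
          ConvertsWith (magicState U) (copies (tCount U - ν) ketT)
            (copies (2 * ν - tCount U) ketT))) ∧
    (∀ n : ℕ, 2 ≤ n →
      (matW n).IsDiag ∧ matW n ∈ cliffordHierarchy n 3 ∧
      nullity (magicState (matW n)) = n ∧ tCount (matW n) = n + 1 ∧
      ConvertsWith (magicState (matW n)) (copies 1 ketT) (copies (n - 1) ketT)) := by
  refine ⟨fun n U hU h3 => diagonal_conversion hU h3, fun n hn => ?_⟩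
  have hdiag : (matW n).IsDiag := Matrix.isDiag_diagonal _
  have h3 : matW n ∈ cliffordHierarchy n 3 := by
    rw [matW_eq]; exact diagonal_mem_third.2 (thirdPhase_diagW n)
  have hnull : nullity (magicState (matW n)) = n := by
    rw [matW_eq, nullity_magicState (thirdPhase_diagW n).ne_zero]
    exact congrArg Nat.cast (diagNullity_diagW hn)
  refine ⟨hdiag, h3, hnull, tCount_matW hn, ?_⟩
  obtain ⟨-, ν, hν, -, -, hconv⟩ := diagonal_conversion hdiag h3
  obtain rfl : ν = n := by rw [hnull] at hν; exact_mod_cast hν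
  have := hconv (by rw [tCount_matW hn]; omega)
  rw [tCount_matW hn] at this
  rwa [show ν + 1 - ν = 1 by omega, show 2 * ν - (ν + 1) = ν - 1 by omega] at this
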